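/- All manifolds are finite-dimensional, Hausdorff and without boundary, and smooth means $C^\infty$. **Lie algebroids.** Let $\tau\colon E\to Q$ be a smooth real vector bundle of finite rank with a Lie algebroid structure $([\![\cdot,\cdot]\!],\rho)$: $\rho\colon E\to TQ$ is a smooth vector bundle map over $\mathrm{id}_Q$, and $[\![\cdot,\cdot]\!]$ is a Lie bracket on the real vector space of smooth sections of $E$ with $[\![\sigma,f\tau]\!]=f[\![\sigma,\tau]\!]+(\rho(\sigma)f)\,\tau$ for all smooth functions $f$ on $Q$. **Prolongations.** For $P=E\times\mathbb R$ or $P=E^*\times\mathbb R$, let $\pi\colon P\to Q$ be the projection. The prolongation $\mathcal T^EP\to P$ is the vector bundle with fibres $$\mathcal T^E_pP=\{(a,v)\in E_{\pi(p)}\times T_pP:\ \rho(a)=T_p\pi(v)\}.$$ It is a Lie algebroid with anchor $(a,v)\mapsto v$ and the following bracket. If $(e_\alpha)$ is a local frame of $E$, $[\![e_\alpha,e_\beta]\!]=C^\gamma_{\alpha\beta}e_\gamma$, and $Z=(a^\alpha\,(e_\alpha\circ\pi),X)$ and $Z'=(b^\alpha\,(e_\alpha\circ\pi),Y)$ are smooth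 local sections, where $a^\alpha,b^\alpha$ are functions on $P$ and $X,Y$ are vector fields on $P$, then $$[\![Z,Z']\!]=\bigl((X(b^\gamma)-Y(a^\gamma)+a^\alpha b^\beta\,(C^\gamma_{\alpha\beta}\circ\pi))\,(e_\gamma\circ\pi),\ [X,Y]\bigr).$$ A $k$-form on $\mathcal T^EP$ is a section of $\Lambda^k(\mathcal T^EP)^*$. Its exterior derivative ${\rm d}={\rm d}^{\mathcal T^EP}$ is given on smooth local sections $Z_i=(\cdot,X_i)$ by $${\rm d}\mu(Z_0,\dots,Z_k)=\sum_i(-1)^iX_i\bigl(\mu(\dots,\widehat{Z_i},\dots)\bigr)+\sum_{i<j}(-1)^{i+j}\mu([\![Z_i,Z_j]\!],\dots,\widehat{Z_i},\dots,\widehat{Z_j},\dots).$$ A smooth vector bundle map $(\Phi,f)$ between two prolongations is a *Lie algebroid morphism* if $(\Phi,f)^*({\rm d}\mu)={\rm d}\bigl((\Phi,f)^*\mu\bigr)$ for every smooth $k$-form $\mu$ on the target and every $k\ge0$. **The Legendre map.** Let $L\colon E\times\mathbb R\to\mathbb R$ be a smooth function (the Lagrangian). It is *regular* if at every point the matrix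 $\bigl(\partial^2L/\partial y^\alpha\partial y^\beta\bigr)$ of second derivatives in linear fibre coordinates $(y^\alpha)$ of $E$ is non-singular. Put $$\mathrm{Leg}_L\colon E\times\mathbb R\to E^*\times\mathbb R,\qquad \mathrm{Leg}_L(b,s)=(\mu(b,s),s),\qquad \mu(b,s)(a)=\frac{d}{dt}\Big|_{t=0}L(b+ta,s)\quad(a,b\in E_q),$$ $$\mathcal T^E\mathrm{Leg}_L\colon\mathcal T^E(E\times\mathbb R)\to\mathcal T^E(E^*\times\mathbb R),\qquad \mathcal T^E\mathrm{Leg}_L(a,v)=(a,T\mathrm{Leg}_L(v)).$$ **Contact sections.** On both prolongations let $\mathcal V^s(a,v)=v(s)$, where $s$ is the coordinate on $\mathbb R$. On $\mathcal T^E(E\times\mathbb R)$ let $S(a,v)=(0,a^V)$ at $(b,s)$, where $a^V$ is the velocity at $t=0$ of $t\mapsto(b+ta,s)$, let $\Theta_L(a,v)=({\rm d}L)(S(a,v))=a^V(L)$, and let $\eta_L=\mathcal V^s-\Theta_L$. On $\mathcal T^E(E^*\times\mathbb R)$ let $\Theta(a,v)=\nu(a)$ at $(\nu,s)$, and let $\eta=\mathcal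 V^s-\Theta$. **Theorem.** Let $L\colon E\times\mathbb R\to\mathbb R$ be a regular Lagrangian. Then the pair $(\mathcal T^E\mathrm{Leg}_L,\mathrm{Leg}_L)$ is a Lie algebroid morphism from $\mathcal T^E(E\times\mathbb R)$ to $\mathcal T^E(E^*\times\mathbb R)$. Moreover, $$(\mathcal T^E\mathrm{Leg}_L,\mathrm{Leg}_L)^*\eta=\eta_L,\qquad(\mathcal T^E\mathrm{Leg}_L,\mathrm{Leg}_L)^*\bigl({\rm d}^{\mathcal T^E(E^*\times\mathbb R)}\eta\bigr)={\rm d}^{\mathcal T^E(E\times\mathbb R)}\eta_L.$$ -/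

import Mathlib

open Bundle Set
open scoped Manifold ContDiff Topology Bundle

noncomputable section

set_option linter.unusedSectionVars false

section
variable {EQ : Type*} [NormedAddCommGroup EQ] [NormedSpace ℝ EQ]
  {Q : Type*} [TopologicalSpace Q] [ChartedSpace EQ Q]
  {F : Type*} [NormedAddCommGroup F] [NormedSpace ℝ F]
  {V : Q → Type*} [TopologicalSpace (TotalSpace F V)] [∀ q, AddCommGroup (V q)]
  [∀ q, Module ℝ (V q)] [∀ q, TopologicalSpace (V q)] [FiberBundle F V] [VectorBundle ℝ F V]

/-- The derivative `v(f)` of a real function `f` at `p` in the direction of a tangent vector `v`,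
as a linear function of `v`. -/
def dirDeriv {EP : Type*} [NormedAddCommGroup EP] [NormedSpace ℝ EP]
    {HP : Type*} [TopologicalSpace HP] (J : ModelWithCorners ℝ EP HP)
    {P : Type*} [TopologicalSpace P] [ChartedSpace HP P] (f : P → ℝ) (p : P) :
    TangentSpace J p →ₗ[ℝ] ℝ where
  toFun v := mfderiv J 𝓘(ℝ, ℝ) f p v
  map_add' v w := ContinuousLinearMap.map_add (mfderiv J 𝓘(ℝ, ℝ) f p) v w
  map_smul' c v := ContinuousLinearMap.map_smul (mfderiv J 𝓘(ℝ, ℝ) f p) c v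

/-- The product `f • σ` of a smooth function and a smooth section. -/
def smoothFunSMul (f : C^∞⟮𝓘(ℝ, EQ), Q; ℝ⟯) (σ : Cₛ^∞⟮𝓘(ℝ, EQ); F, V⟯) :
    Cₛ^∞⟮𝓘(ℝ, EQ); F, V⟯ where
  toFun q := f q • σ q
  contMDiff_toFun := ContMDiff.smul_section f.contMDiff σ.contMDiff

variable [IsManifold 𝓘(ℝ, EQ) ∞ Q]

variable (EQ F V) in
/-- A Lie algebroid structure on the smooth vector bundle `V → Q`: a smooth anchor
`V → TQ`, linear on fibres, and a Lie bracket on the space of smooth sections satisfying the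
Leibniz rule. -/
structure LieAlgebroid where
  anchor : ∀ q : Q, V q →ₗ[ℝ] TangentSpace 𝓘(ℝ, EQ) q
  contMDiff_anchor : ContMDiff (𝓘(ℝ, EQ).prod 𝓘(ℝ, F)) 𝓘(ℝ, EQ).tangent ∞
    (fun e : TotalSpace F V ↦ (⟨e.proj, anchor e.proj e.snd⟩ : TangentBundle 𝓘(ℝ, EQ) Q))
  bracket : Cₛ^∞⟮𝓘(ℝ, EQ); F, V⟯ →ₗ[ℝ] Cₛ^∞⟮𝓘(ℝ, EQ); F, V⟯ →ₗ[ℝ] Cₛ^∞⟮𝓘(ℝ, EQ); F, V⟯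
  bracket_self : ∀ σ, bracket σ σ = 0
  jacobi : ∀ σ τ υ, bracket σ (bracket τ υ) + bracket τ (bracket υ σ)
    + bracket υ (bracket σ τ) = 0
  leibniz : ∀ (f : C^∞⟮𝓘(ℝ, EQ), Q; ℝ⟯) (σ τ : Cₛ^∞⟮𝓘(ℝ, EQ); F, V⟯) (q : Q),
    bracket σ (smoothFunSMul f τ) q =
      f q • bracket σ τ q + dirDeriv 𝓘(ℝ, EQ) f q (anchor q (σ q)) • τ q

section extend
variable [FiniteDimensional ℝ EQ] [T2Space Q]

variable (EQ F V) in
theorem exists_bump_trivializationAt (q : Q) : ∃ χ : SmoothBumpFunction 𝓘(ℝ, EQ) q,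
    tsupport χ ⊆ (trivializationAt F V q).baseSet := by
  obtain ⟨χ, -, h⟩ := (SmoothBumpFunction.nhds_basis_tsupport (I := 𝓘(ℝ, EQ)) q).mem_iff.1
    ((trivializationAt F V q).open_baseSet.mem_nhds (FiberBundle.mem_baseSet_trivializationAt' q))
  exact ⟨χ, h⟩

variable [ContMDiffVectorBundle ∞ F V 𝓘(ℝ, EQ)]

variable (EQ F) in
/-- A smooth section of `V` with value `a` at `q` which near `q` is constant in the preferred
trivialization of `V` at `q`. -/
def constSection {q : Q} (a : V q) : Cₛ^∞⟮𝓘(ℝ, EQ); F, V⟯ where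
  toFun := ⇑(exists_bump_trivializationAt EQ F V q).choose • FiberBundle.extend F a
  contMDiff_toFun := by
    set χ := (exists_bump_trivializationAt EQ F V q).choose
    have hχ := (exists_bump_trivializationAt EQ F V q).choose_spec
    refine ContMDiffOn.smul_section_of_tsupport χ.contMDiff.contMDiffOn
      (trivializationAt F V q).open_baseSet hχ ?_
    intro x hx
    rw [(trivializationAt F V q).contMDiffWithinAt_section _ hx]
    refine (contMDiffOn_const (c := (trivializationAt F V q ⟨q, a⟩).2)).congr
      (s := (trivializationAt F V q).baseSet) (fun y hy ↦ ?_) x hx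
    simp [FiberBundle.extend, hy]

end extend

namespace LieAlgebroid

variable (𝔸 : LieAlgebroid EQ F V)

section prolongation

variable {EP : Type*} [NormedAddCommGroup EP] [NormedSpace ℝ EP]
  {HP : Type*} [TopologicalSpace HP] (J : ModelWithCorners ℝ EP HP)
  {P : Type*} [TopologicalSpace P] [ChartedSpace HP P] (pr : P → Q)

/-- The fibre at `p` of the prolongation of the Lie algebroid `V` over `pr : P → Q`. -/
def Prolongation (p : P) : Submodule ℝ (V (pr p) × TangentSpace J p) :=
  LinearMap.eqLocus (𝔸.anchor (pr p) ∘ₗ LinearMap.fst ℝ (V (pr p)) (TangentSpace J p))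
    ((mfderiv J 𝓘(ℝ, EQ) pr p).toLinearMap ∘ₗ LinearMap.snd ℝ (V (pr p)) (TangentSpace J p))

variable [IsManifold J ∞ P]

/-- Smoothness on `U` of a map `σ` into the total space of the prolongation, which covers
`f : N → P`: both components of `σ` are smooth. -/
def SmoothAlongOn {EN : Type*} [NormedAddCommGroup EN] [NormedSpace ℝ EN]
    {HN : Type*} [TopologicalSpace HN] (JN : ModelWithCorners ℝ EN HN)
    {N : Type*} [TopologicalSpace N] [ChartedSpace HN N]
    (f : N → P) (σ : ∀ x : N, 𝔸.Prolongation J pr (f x)) (U : Set N) : Prop :=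
  ContMDiffOn JN (𝓘(ℝ, EQ).prod 𝓘(ℝ, F)) ∞
    (fun x ↦ (⟨pr (f x), (σ x).1.1⟩ : TotalSpace F V)) U ∧
  ContMDiffOn JN J.tangent ∞ (fun x ↦ (⟨f x, (σ x).1.2⟩ : TangentBundle J P)) U

/-- Smoothness on `U` of a section of the prolongation. -/
def SmoothSectionOn (σ : ∀ p : P, 𝔸.Prolongation J pr p) (U : Set P) : Prop :=
  𝔸.SmoothAlongOn J pr J id σ U

/-- A `k`-form on the prolongation: a section of the `k`-th exterior power of its dual. -/
abbrev ProlongationForm (k : ℕ) : Type _ := ∀ p : P, 𝔸.Prolongation J pr p [⋀^Fin k]→ₗ[ℝ] ℝ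

/-- A form is smooth if its values on local smooth sections are smooth functions. -/
def SmoothForm {k : ℕ} (μ : 𝔸.ProlongationForm J pr k) : Prop :=
  ∀ (U : Set P) (σ : Fin k → ∀ p : P, 𝔸.Prolongation J pr p), IsOpen U →
    (∀ i, 𝔸.SmoothSectionOn J pr (σ i) U) →
    ContMDiffOn J 𝓘(ℝ, ℝ) ∞ (fun p ↦ μ p (fun i ↦ σ i p)) U

variable [FiniteDimensional ℝ EQ] [T2Space Q] [ContMDiffVectorBundle ∞ F V 𝓘(ℝ, EQ)]

/-- The derivative at `p`, in the direction of a tangent vector `v` of `P`, of a section `a` of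
`V` along `pr`, with respect to the flat connection of the preferred trivialization of `V`
at `pr p`. -/
def flatDeriv (a : ∀ p : P, V (pr p)) (p : P) (v : TangentSpace J p) : V (pr p) :=
  (trivializationAt F V (pr p)).symm (pr p)
    (mfderiv J 𝓘(ℝ, F) (fun p' ↦ (trivializationAt F V (pr p) ⟨pr p', a p'⟩).2) p v)

/-- The Lie bracket of the sections `σ = (a, X)` and `τ = (b, Y)` of the prolongation, as an
element of `V (pr p) × T_p P`. If `e_α` is the frame of `V` given by the preferred
trivialization at `pr p`, `⟦e_α, e_β⟧ = C^γ_{αβ} e_γ`, `a = a^α (e_α ∘ pr)` and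
`b = b^α (e_α ∘ pr)`, then its first component is
`(X(b^γ) - Y(a^γ) + a^α b^β C^γ_{αβ}(pr p)) e_γ(pr p)`, and the second one is `[X, Y](p)`. -/
def prolongationBracketAux (σ τ : ∀ p : P, 𝔸.Prolongation J pr p) (p : P) :
    V (pr p) × TangentSpace J p :=
  (𝔸.bracket (constSection EQ F (σ p).1.1) (constSection EQ F (τ p).1.1) (pr p)
      + flatDeriv (F := F) J pr (fun p' ↦ (τ p').1.1) p (σ p).1.2
      - flatDeriv (F := F) J pr (fun p' ↦ (σ p').1.1) p (τ p).1.2,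
    VectorField.mlieBracket J (fun p' ↦ (σ p').1.2) (fun p' ↦ (τ p').1.2) p)

open Classical in
/-- The Lie bracket of sections of the prolongation. For sections which are smooth near `p` the
condition holds automatically; the value `0` is never used for them. -/
def prolongationBracket (σ τ : ∀ p : P, 𝔸.Prolongation J pr p) (p : P) :
    𝔸.Prolongation J pr p :=
  if h : 𝔸.prolongationBracketAux J pr σ τ p ∈ 𝔸.Prolongation J pr p then ⟨_, h⟩ else 0

/-- The terms with brackets in the formula for the exterior derivative of `μ` at `p`:
the sum over `i < j` of
`(-1)^(i + j) μ(⟦σ_i, σ_j⟧, σ_0, …, omit σ_i, …, omit σ_j, …, σ_k)`; the pairs `i < j` in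
`{0, …, k}` are enumerated as `(i, j + 1)` with `i ≤ j` in `{0, …, k - 1}`. -/
def bracketTerms : {k : ℕ} → 𝔸.ProlongationForm J pr k →
    (Fin (k + 1) → ∀ p : P, 𝔸.Prolongation J pr p) → P → ℝ
  | 0, _, _, _ => 0
  | k + 1, μ, σ, p => ∑ i : Fin (k + 1), ∑ j ∈ Finset.Ici i,
      (-1 : ℝ) ^ ((i : ℕ) + ((j : ℕ) + 1)) *
        μ p (Fin.cons (𝔸.prolongationBracket J pr (σ i.castSucc) (σ j.succ) p)
          (j.removeNth (i.castSucc.removeNth (fun l ↦ σ l p))))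

/-- The value of the exterior derivative of `μ` on the sections `σ_0, …, σ_k`, at `p`. -/
def koszul {k : ℕ} (μ : 𝔸.ProlongationForm J pr k)
    (σ : Fin (k + 1) → ∀ p : P, 𝔸.Prolongation J pr p) (p : P) : ℝ :=
  ∑ i : Fin (k + 1), (-1 : ℝ) ^ (i : ℕ) *
      dirDeriv J (fun p' ↦ μ p' (i.removeNth (fun l ↦ σ l p'))) p (σ i p).1.2
    + 𝔸.bracketTerms J pr μ σ p

open Classical in
/-- A section of the prolongation through `w`, smooth near `p`. -/
def sectionThrough {p : P} (w : 𝔸.Prolongation J pr p) : ∀ p' : P, 𝔸.Prolongation J pr p' :=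
  if h : ∃ σ : ∀ p' : P, 𝔸.Prolongation J pr p', σ p = w ∧
    ∃ U ∈ 𝓝 p, IsOpen U ∧ 𝔸.SmoothSectionOn J pr σ U then h.choose else fun _ ↦ 0

/-- The exterior derivative of a form on the prolongation, as a function of `k + 1` elements of
a fibre. They are extended to local smooth sections; the value does not depend on the
extensions. -/
def extDeriv {k : ℕ} (μ : 𝔸.ProlongationForm J pr k) (p : P)
    (w : Fin (k + 1) → 𝔸.Prolongation J pr p) : ℝ :=
  𝔸.koszul J pr μ (fun i ↦ 𝔸.sectionThrough J pr (w i)) p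

end prolongation

section morphism

variable {EP : Type*} [NormedAddCommGroup EP] [NormedSpace ℝ EP]
  {HP : Type*} [TopologicalSpace HP] (J : ModelWithCorners ℝ EP HP)
  {P : Type*} [TopologicalSpace P] [ChartedSpace HP P] [IsManifold J ∞ P] (pr : P → Q)
  {EP' : Type*} [NormedAddCommGroup EP'] [NormedSpace ℝ EP']
  {HP' : Type*} [TopologicalSpace HP'] (J' : ModelWithCorners ℝ EP' HP')
  {P' : Type*} [TopologicalSpace P'] [ChartedSpace HP' P'] [IsManifold J' ∞ P'] (pr' : P' → Q)

variable {J pr J' pr'} in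
/-- The pullback of a form by a fibrewise linear map covering `f : P → P'`. -/
def pullbackForm {f : P → P'}
    (Φ : ∀ p : P, 𝔸.Prolongation J pr p →ₗ[ℝ] 𝔸.Prolongation J' pr' (f p)) {k : ℕ}
    (μ : 𝔸.ProlongationForm J' pr' k) : 𝔸.ProlongationForm J pr k :=
  fun p ↦ (μ (f p)).compLinearMap (Φ p)

/-- The fibrewise linear map `Φ` covering `f : P → P'` is a morphism of Lie algebroids between
prolongations: it is a smooth morphism of vector bundles, and the pullback of smooth forms of any
degree commutes with the exterior derivatives. -/
structure IsLieAlgebroidMorphism [FiniteDimensional ℝ EQ] [T2Space Q]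
    [ContMDiffVectorBundle ∞ F V 𝓘(ℝ, EQ)] (f : P → P')
    (Φ : ∀ p : P, 𝔸.Prolongation J pr p →ₗ[ℝ] 𝔸.Prolongation J' pr' (f p)) : Prop where
  smooth_base : ContMDiff J J' ∞ f
  smooth_total : ∀ (U : Set P) (σ : ∀ p : P, 𝔸.Prolongation J pr p), IsOpen U →
    𝔸.SmoothSectionOn J pr σ U → 𝔸.SmoothAlongOn J' pr' J f (fun p ↦ Φ p (σ p)) U
  extDeriv_pullbackForm : ∀ (k : ℕ) (μ : 𝔸.ProlongationForm J' pr' k), 𝔸.SmoothForm J' pr' μ →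
    ∀ (p : P) (w : Fin (k + 1) → 𝔸.Prolongation J pr p),
      𝔸.extDeriv J pr (𝔸.pullbackForm Φ μ) p w = 𝔸.extDeriv J' pr' μ (f p) (fun i ↦ Φ p (w i))

end morphism

end LieAlgebroid
end

section contact

variable {EQ : Type*} [NormedAddCommGroup EQ] [NormedSpace ℝ EQ]
  {Q : Type*} [TopologicalSpace Q] [ChartedSpace EQ Q]
  {F : Type*} [NormedAddCommGroup F] [NormedSpace ℝ F]
  {V : Q → Type*} [TopologicalSpace (TotalSpace F V)] [∀ q, AddCommGroup (V q)]
  [∀ q, Module ℝ (V q)] [∀ q, TopologicalSpace (V q)] [FiberBundle F V] [VectorBundle ℝ F V]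

variable (EQ F) in
/-- The model of the manifold `V × ℝ`, where `V → Q` is a vector bundle with fibre `F`. -/
abbrev timesRealModel : ModelWithCorners ℝ ((EQ × F) × ℝ) (ModelProd (ModelProd EQ F) ℝ) :=
  (𝓘(ℝ, EQ).prod 𝓘(ℝ, F)).prod 𝓘(ℝ, ℝ)

variable (F V) in
/-- The projection `V × ℝ → Q`. -/
abbrev timesRealProj : TotalSpace F V × ℝ → Q := fun p ↦ p.1.proj

variable [IsManifold 𝓘(ℝ, EQ) ∞ Q] [ContMDiffVectorBundle ∞ F V 𝓘(ℝ, EQ)]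

variable (F V) in
/-- The inclusion of the fibre of `V × ℝ` over `q` at height `s`, read in the preferred
trivialization. -/
def fibreMap (q : Q) (s : ℝ) (y : F) : TotalSpace F V × ℝ :=
  (⟨q, (trivializationAt F V q).symm q y⟩, s)

theorem contMDiff_fibreMap (q : Q) (s : ℝ) :
    ContMDiff 𝓘(ℝ, F) (timesRealModel EQ F) ∞ (fibreMap F V q s) := by
  refine ContMDiff.prodMk (fun y ↦ ?_) contMDiff_const
  rw [contMDiffAt_totalSpace]
  refine ⟨contMDiffAt_const, ?_⟩
  refine contMDiffAt_id.congr_of_eventuallyEq (Filter.Eventually.of_forall fun y' ↦ ?_)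
  simp [FiberBundle.mem_baseSet_trivializationAt']

theorem fibreMap_trivializationAt (p : TotalSpace F V × ℝ) (a : V p.1.proj) (t : ℝ) :
    ((⟨p.1.proj, p.1.snd + t • a⟩, p.2) : TotalSpace F V × ℝ) =
      fibreMap F V p.1.proj p.2
        ((trivializationAt F V p.1.proj).continuousLinearEquivAt ℝ p.1.proj
            (FiberBundle.mem_baseSet_trivializationAt' p.1.proj) p.1.snd +
          t • (trivializationAt F V p.1.proj).continuousLinearEquivAt ℝ p.1.proj
            (FiberBundle.mem_baseSet_trivializationAt' p.1.proj) a) := by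
  rw [← map_smul, ← map_add, fibreMap]
  congr 2
  exact (((trivializationAt F V p.1.proj).continuousLinearEquivAt ℝ p.1.proj
            (FiberBundle.mem_baseSet_trivializationAt' p.1.proj)).symm_apply_apply _).symm


variable (EQ) in
/-- The derivative at `y` of the inclusion of the fibre, on the fibre itself. -/
def fibreMapDeriv (p : TotalSpace F V × ℝ) :
    V p.1.proj →L[ℝ] TangentSpace (timesRealModel EQ F) p :=
  let φ := (trivializationAt F V p.1.proj).continuousLinearEquivAt ℝ p.1.proj
            (FiberBundle.mem_baseSet_trivializationAt' p.1.proj)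
  (mfderiv 𝓘(ℝ, F) (timesRealModel EQ F) (fibreMap F V p.1.proj p.2) (φ p.1.snd)).comp
   (φ : V p.1.proj →L[ℝ] F)

theorem mdifferentiableAt_fibre_curve (p : TotalSpace F V × ℝ) (a : V p.1.proj) :
    MDifferentiableAt 𝓘(ℝ, ℝ) (timesRealModel EQ F)
      (fun t : ℝ ↦ ((⟨p.1.proj, p.1.snd + t • a⟩, p.2) : TotalSpace F V × ℝ)) 0 := by
  simp_rw [fibreMap_trivializationAt]
  set φ := (trivializationAt F V p.1.proj).continuousLinearEquivAt ℝ p.1.proj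
            (FiberBundle.mem_baseSet_trivializationAt' p.1.proj) with hφ
  have h1 : MDifferentiableAt 𝓘(ℝ, ℝ) 𝓘(ℝ, F) (fun t : ℝ ↦ φ p.1.snd + t • φ a) 0 :=
    ((differentiableAt_id (𝕜 := ℝ) (x := (0 : ℝ))).smul_const (φ a)).const_add _
      |>.mdifferentiableAt
  exact MDifferentiableAt.comp (0 : ℝ)
    ((contMDiff_fibreMap p.1.proj p.2).mdifferentiableAt (by simp)) h1

theorem mfderiv_fibre_curve (p : TotalSpace F V × ℝ) (a : V p.1.proj) :
    mfderiv 𝓘(ℝ, ℝ) (timesRealModel EQ F)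
      (fun t : ℝ ↦ ((⟨p.1.proj, p.1.snd + t • a⟩, p.2) : TotalSpace F V × ℝ)) 0 (1 : ℝ)
      = fibreMapDeriv EQ p a := by
  set φ := (trivializationAt F V p.1.proj).continuousLinearEquivAt ℝ p.1.proj
            (FiberBundle.mem_baseSet_trivializationAt' p.1.proj) with hφ
  have h1 : HasFDerivAt (fun t : ℝ ↦ φ p.1.snd + t • φ a)
      ((ContinuousLinearMap.id ℝ ℝ).smulRight (φ a)) 0 :=
    ((hasFDerivAt_id (𝕜 := ℝ) (0 : ℝ)).smul_const (φ a)).const_add _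
  have h2 := (((contMDiff_fibreMap (EQ := EQ) (V := V) (F := F) p.1.proj p.2).mdifferentiableAt
    (x := φ p.1.snd + (0 : ℝ) • φ a) (by simp)).hasMFDerivAt)
  have h3 := (HasMFDerivAt.comp (0 : ℝ) h2 h1.hasMFDerivAt).mfderiv
  have h4 := congrArg (fun l : ℝ →L[ℝ] ((EQ × F) × ℝ) ↦ l 1) h3
  have h5 : ∀ c : ℝ → TotalSpace F V × ℝ,
      c = fibreMap F V p.1.proj p.2 ∘ (fun t : ℝ ↦ φ p.1.snd + t • φ a) →
      (show (EQ × F) × ℝ from mfderiv 𝓘(ℝ, ℝ) (timesRealModel EQ F) c 0 (1 : ℝ)) =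
      fibreMapDeriv EQ p a := by
    rintro _ rfl
    refine h4.trans ?_
    change mfderiv 𝓘(ℝ, F) (timesRealModel EQ F) (fibreMap F V p.1.proj p.2)
        (φ p.1.snd + (0 : ℝ) • φ a) ((1 : ℝ) • φ a) =
      mfderiv 𝓘(ℝ, F) (timesRealModel EQ F) (fibreMap F V p.1.proj p.2)
        (φ p.1.snd) (φ a)
    rw [zero_smul, add_zero, one_smul]
  exact h5 _ (funext fun t ↦ fibreMap_trivializationAt p a t)

variable (EQ) in
/-- The vertical lift of `a` at `p = (b, s)`: the velocity at `t = 0` of the curve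
`t ↦ (b + t a, s)`. -/
def verticalLift (p : TotalSpace F V × ℝ) :
    V p.1.proj →ₗ[ℝ] TangentSpace (timesRealModel EQ F) p where
  toFun a := mfderiv 𝓘(ℝ, ℝ) (timesRealModel EQ F)
    (fun t : ℝ ↦ ((⟨p.1.proj, p.1.snd + t • a⟩, p.2) : TotalSpace F V × ℝ)) 0 (1 : ℝ)
  map_add' a b := by
    rw [mfderiv_fibre_curve, mfderiv_fibre_curve, mfderiv_fibre_curve]
    exact map_add (fibreMapDeriv EQ p) a b
  map_smul' c a := by
    rw [mfderiv_fibre_curve, mfderiv_fibre_curve]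
    exact map_smul (fibreMapDeriv EQ p) c a

theorem mfderiv_timesRealProj_verticalLift (p : TotalSpace F V × ℝ) (a : V p.1.proj) :
    mfderiv (timesRealModel EQ F) 𝓘(ℝ, EQ) (timesRealProj F V) p (verticalLift EQ p a) = 0 := by
  have h1 : MDifferentiableAt (timesRealModel EQ F) 𝓘(ℝ, EQ) (timesRealProj F V)
      (⟨p.1.proj, p.1.snd + (0 : ℝ) • a⟩, p.2) :=
    ((contMDiff_proj (n := 1) V).comp contMDiff_fst).mdifferentiableAt (by simp)
  have h2 := mfderiv_comp (0 : ℝ) h1 (mdifferentiableAt_fibre_curve (EQ := EQ) p a)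
  have h3 := congrArg (fun l : ℝ →L[ℝ] EQ ↦ l 1) h2
  have h4 : mfderiv 𝓘(ℝ, ℝ) 𝓘(ℝ, EQ) (timesRealProj F V ∘
      (fun t : ℝ ↦ ((⟨p.1.proj, p.1.snd + t • a⟩, p.2) : TotalSpace F V × ℝ))) 0 = 0 :=
    mfderiv_const
  rw [h4] at h3
  have h5 : ((⟨p.1.proj, p.1.snd + (0 : ℝ) • a⟩, p.2) : TotalSpace F V × ℝ) = p := by
    rw [zero_smul, add_zero]
  have h6 : ∀ p', p' = p → ∀ v : (EQ × F) × ℝ,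
      (show EQ from mfderiv (timesRealModel EQ F) 𝓘(ℝ, EQ) (timesRealProj F V) p' v) =
      mfderiv (timesRealModel EQ F) 𝓘(ℝ, EQ) (timesRealProj F V) p v := by
    rintro _ rfl v; rfl
  exact (h6 _ h5 _).symm.trans h3.symm

variable (L : C^∞⟮timesRealModel EQ F, TotalSpace F V × ℝ; ℝ⟯)

theorem deriv_fibre_curve (p : TotalSpace F V × ℝ) (a : V p.1.proj) :
    deriv (fun t : ℝ ↦ L (⟨p.1.proj, p.1.snd + t • a⟩, p.2)) 0 =
      mfderiv (timesRealModel EQ F) 𝓘(ℝ, ℝ) L p (fibreMapDeriv EQ p a) := by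
  have h1 : MDifferentiableAt (timesRealModel EQ F) 𝓘(ℝ, ℝ) L
      (⟨p.1.proj, p.1.snd + (0 : ℝ) • a⟩, p.2) :=
    L.contMDiff.mdifferentiableAt (by simp)
  have h2 := mfderiv_comp (0 : ℝ) h1 (mdifferentiableAt_fibre_curve (EQ := EQ) p a)
  have h3 := congrArg (fun l : ℝ →L[ℝ] ℝ ↦ l 1) h2
  rw [mfderiv_eq_fderiv] at h3
  have h5 : ((⟨p.1.proj, p.1.snd + (0 : ℝ) • a⟩, p.2) : TotalSpace F V × ℝ) = p := by
    rw [zero_smul, add_zero]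
  have h6 : ∀ p', p' = p → ∀ v : (EQ × F) × ℝ,
      (show ℝ from mfderiv (timesRealModel EQ F) 𝓘(ℝ, ℝ) L p' v) =
      mfderiv (timesRealModel EQ F) 𝓘(ℝ, ℝ) L p v := by
    rintro _ rfl v; rfl
  rw [← mfderiv_fibre_curve]
  exact h3.trans (h6 _ h5 _)

/-- The fibre derivative of `L` at `p = (b, s)`, an element of the dual of the fibre:
`a ↦ d/dt|_{t = 0} L(b + t a, s)`. -/
def fibreDeriv (p : TotalSpace F V × ℝ) : V p.1.proj →L[ℝ] ℝ where
  toFun a := deriv (fun t : ℝ ↦ L (⟨p.1.proj, p.1.snd + t • a⟩, p.2)) 0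
  map_add' a b := by
    simp only [deriv_fibre_curve]
    exact map_add ((mfderiv (timesRealModel EQ F) 𝓘(ℝ, ℝ) L p).comp (fibreMapDeriv EQ p)) a b
  map_smul' c a := by
    simp only [deriv_fibre_curve]
    exact map_smul ((mfderiv (timesRealModel EQ F) 𝓘(ℝ, ℝ) L p).comp (fibreMapDeriv EQ p)) c a
  cont := by
    simp only [deriv_fibre_curve]
    exact ((mfderiv (timesRealModel EQ F) 𝓘(ℝ, ℝ) L p).comp (fibreMapDeriv EQ p)).continuous

/-- The Lagrangian `L` is regular: at every point `p = (b, s)` the matrix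
`∂²L/∂y^α∂y^β` of second derivatives along the fibre, with respect to the linear coordinates
`y^α` given by a basis of the fibre, is non-singular. -/
def IsRegularLagrangian : Prop :=
  ∀ (p : TotalSpace F V × ℝ)
    (e : Module.Basis (Fin (Module.finrank ℝ (V p.1.proj))) ℝ (V p.1.proj)),
    (Matrix.of fun α β ↦ deriv (fun t : ℝ ↦
      fibreDeriv L (⟨p.1.proj, p.1.snd + t • e α⟩, p.2) (e β)) 0).det ≠ 0

variable [∀ q, IsTopologicalAddGroup (V q)] [∀ q, ContinuousSMul ℝ (V q)]

/-- The Legendre transformation `V × ℝ → V* × ℝ` of `L`. -/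
def legendre (p : TotalSpace F V × ℝ) :
    TotalSpace (F →L[ℝ] ℝ) (fun q ↦ V q →L[ℝ] ℝ) × ℝ :=
  (⟨p.1.proj, fibreDeriv L p⟩, p.2)

theorem fderiv_trivialization_eq (e : Bundle.Trivialization F (TotalSpace.proj : TotalSpace F V → Q))
    [MemTrivializationAtlas e] (p : TotalSpace F V × ℝ) (hp : p.1.proj ∈ e.baseSet) (z : F) :
    fderiv ℝ (fun y ↦ L (⟨p.1.proj, e.symm p.1.proj y⟩, p.2)) (e p.1).2 z =
      fibreDeriv L p (e.symm p.1.proj z) := by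
  have hs : ContMDiff 𝓘(ℝ, F) 𝓘(ℝ, ℝ) ∞
      (fun y ↦ L (⟨p.1.proj, e.symm p.1.proj y⟩, p.2)) := by
    refine L.contMDiff.comp (ContMDiff.prodMk (fun y ↦ ?_) contMDiff_const)
    rw [e.contMDiffAt_iff (IB := 𝓘(ℝ, EQ)) (by simpa [e.mem_source] using hp)]
    refine ⟨contMDiffAt_const, ?_⟩
    refine contMDiffAt_id.congr_of_eventuallyEq (Filter.Eventually.of_forall fun y' ↦ ?_)
    simp [hp]
  have h1 : DifferentiableAt ℝ (fun y ↦ L (⟨p.1.proj, e.symm p.1.proj y⟩, p.2)) (e p.1).2 :=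
    (hs.contDiff.differentiable (by simp)) _
  rw [← h1.lineDeriv_eq_fderiv]
  change deriv _ 0 = deriv _ 0
  congr 1
  funext t
  have h2 : e.symm p.1.proj ((e p.1).2 + t • z) = p.1.snd + t • e.symm p.1.proj z := by
    have h3 := map_add (e.symmL ℝ p.1.proj) (e p.1).2 (t • z)
    rw [map_smul] at h3
    rw [e.symmL_apply hp, e.symmL_apply hp, e.symmL_apply hp] at h3
    rw [h3]
    congr 1
    exact e.symm_apply_apply_mk hp p.1.snd
  exact congrArg (fun b ↦ L ((⟨p.1.proj, b⟩ : TotalSpace F V), p.2)) h2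

theorem contMDiff_legendre :
    ContMDiff (timesRealModel EQ F) (timesRealModel EQ (F →L[ℝ] ℝ)) ∞ (legendre L) := by
  refine ContMDiff.prodMk (fun p ↦ ?_) contMDiff_snd
  have hproj : ContMDiff (timesRealModel EQ F) 𝓘(ℝ, EQ) ∞ (timesRealProj F V) :=
    (contMDiff_proj V).comp contMDiff_fst
  rw [contMDiffAt_hom_bundle (E₂ := fun _ ↦ ℝ)]
  refine ⟨hproj.contMDiffAt, ?_⟩
  set e := trivializationAt F V p.1.proj with he
  have hpe : p.1.proj ∈ e.baseSet := FiberBundle.mem_baseSet_trivializationAt' p.1.proj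
  have hU : ∀ᶠ x : TotalSpace F V × ℝ in 𝓝 p, x.1.proj ∈ e.baseSet :=
    hproj.continuous.continuousAt (e.open_baseSet.mem_nhds hpe)
  have hg : ContMDiffAt (timesRealModel EQ F) 𝓘(ℝ, F) ∞
      (fun x : TotalSpace F V × ℝ ↦ (e x.1).2) p :=
    ((e.contMDiffAt_iff (IB := 𝓘(ℝ, EQ)) (e.mem_source.2 hpe)).1
      (contMDiff_fst.contMDiffAt (x := p))).2
  have hf : ContMDiffAt ((timesRealModel EQ F).prod 𝓘(ℝ, F)) 𝓘(ℝ, ℝ) ∞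
      (Function.uncurry fun (x : TotalSpace F V × ℝ) (y : F) ↦
        L (⟨x.1.proj, e.symm x.1.proj y⟩, x.2)) (p, (e p.1).2) := by
    refine L.contMDiff.contMDiffAt.comp _ (ContMDiffAt.prodMk ?_
      (contMDiff_snd.comp contMDiff_fst).contMDiffAt)
    refine (e.contMDiffAt_iff (IB := 𝓘(ℝ, EQ)) (n := ∞) (x₀ := (p, (e p.1).2))
      (f := fun x : (TotalSpace F V × ℝ) × F ↦
        (⟨x.1.1.proj, e.symm x.1.1.proj x.2⟩ : TotalSpace F V)) (e.mem_source.2 hpe)).2 ?_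
    refine ⟨(hproj.comp contMDiff_fst).contMDiffAt, ?_⟩
    refine contMDiff_snd.contMDiffAt.congr_of_eventuallyEq ?_
    filter_upwards [continuous_fst.continuousAt.eventually hU] with x hx
    simp [hx]
  have h := ContMDiffAt.mfderiv (m := ∞) _ _ hf hg (by simp)
  refine h.congr_of_eventuallyEq ?_
  filter_upwards [hU] with x hx
  ext z
  simp only [inTangentCoordinates_model_space, mfderiv_eq_fderiv]
  rw [ContinuousLinearMap.inCoordinates_eq hx (by simp)]
  refine Eq.trans ?_ (fderiv_trivialization_eq L e x hx z).symm
  simp [he]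

/-- The prolonged Legendre transformation `(a, v) ↦ (a, T(Leg) v)` between the prolongations of
a Lie algebroid over `V × ℝ` and over `V* × ℝ`. -/
def prolongedLegendre (𝔸 : LieAlgebroid EQ F V) (p : TotalSpace F V × ℝ) :
    𝔸.Prolongation (timesRealModel EQ F) (timesRealProj F V) p →ₗ[ℝ]
      𝔸.Prolongation (timesRealModel EQ (F →L[ℝ] ℝ))
        (timesRealProj (F →L[ℝ] ℝ) (fun q ↦ V q →L[ℝ] ℝ)) (legendre L p) where
  toFun x := ⟨(x.1.1, mfderiv (timesRealModel EQ F) (timesRealModel EQ (F →L[ℝ] ℝ))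
      (legendre L) p x.1.2), by
    have h1 : MDifferentiableAt (timesRealModel EQ (F →L[ℝ] ℝ)) 𝓘(ℝ, EQ)
        (timesRealProj (F →L[ℝ] ℝ) (fun q ↦ V q →L[ℝ] ℝ)) (legendre L p) :=
      ((contMDiff_proj (n := 1) (fun q ↦ V q →L[ℝ] ℝ)).comp contMDiff_fst).mdifferentiableAt
        (by simp)
    have h2 := mfderiv_comp p h1 ((contMDiff_legendre L).mdifferentiableAt (by simp))
    have h3 := congrArg (fun l : ((EQ × F) × ℝ) →L[ℝ] EQ ↦ l x.1.2) h2
    have h4 : 𝔸.anchor p.1.proj x.1.1 =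
      mfderiv (timesRealModel EQ F) 𝓘(ℝ, EQ) (timesRealProj F V) p x.1.2 := x.2
    exact h4.trans h3⟩
  map_add' x y := Subtype.ext (Prod.ext rfl (ContinuousLinearMap.map_add _ _ _))
  map_smul' c x := Subtype.ext (Prod.ext rfl (ContinuousLinearMap.map_smul _ _ _))

/-- The vertical endomorphism `S(a, v) = (0, a^V)` of the prolongation over `V × ℝ`. -/
def verticalEndomorphism (𝔸 : LieAlgebroid EQ F V) (p : TotalSpace F V × ℝ) :
    𝔸.Prolongation (timesRealModel EQ F) (timesRealProj F V) p →ₗ[ℝ]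
      𝔸.Prolongation (timesRealModel EQ F) (timesRealProj F V) p where
  toFun x := ⟨(0, verticalLift EQ p x.1.1),
    (map_zero (𝔸.anchor p.1.proj)).trans (mfderiv_timesRealProj_verticalLift p x.1.1).symm⟩
  map_add' _ _ := Subtype.ext (Prod.ext (add_zero _).symm (map_add (verticalLift EQ p) _ _))
  map_smul' _ _ := Subtype.ext (Prod.ext (smul_zero _).symm (map_smul (verticalLift EQ p) _ _))

/-- The `1`-form on the prolongation given by linear functions on the fibres. -/
def LieAlgebroid.oneForm {𝔸 : LieAlgebroid EQ F V} {EP : Type*} [NormedAddCommGroup EP]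
    [NormedSpace ℝ EP] {HP : Type*} [TopologicalSpace HP] {J : ModelWithCorners ℝ EP HP}
    {P : Type*} [TopologicalSpace P] [ChartedSpace HP P] {pr : P → Q} [IsManifold J ∞ P]
    (μ : ∀ p : P, 𝔸.Prolongation J pr p →ₗ[ℝ] ℝ) : 𝔸.ProlongationForm J pr 1 :=
  fun p ↦ AlternatingMap.ofSubsingleton ℝ _ ℝ 0 (μ p)

/-- The component `v(s)` along `ℝ` of a tangent vector `v` of `V × ℝ`, as a linear form on the
prolongation: `𝒱^s(a, v) = v(s)`. -/
def sComponent (𝔸 : LieAlgebroid EQ F V) {G : Type*} [NormedAddCommGroup G] [NormedSpace ℝ G]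
    {W : Q → Type*} [TopologicalSpace (TotalSpace G W)] [∀ q, TopologicalSpace (W q)]
    [FiberBundle G W] (p : TotalSpace G W × ℝ) :
    𝔸.Prolongation (timesRealModel EQ G) (timesRealProj G W) p →ₗ[ℝ] ℝ where
  toFun x := dirDeriv (timesRealModel EQ G) (Prod.snd : TotalSpace G W × ℝ → ℝ) p x.1.2
  map_add' x y := map_add _ x.1.2 y.1.2
  map_smul' c x := map_smul _ c x.1.2

/-- The Poincaré-Cartan `1`-section `Θ_L(a, v) = ρ^π(S(a, v)) L`. -/
def poincareCartan (𝔸 : LieAlgebroid EQ F V) (p : TotalSpace F V × ℝ) :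
    𝔸.Prolongation (timesRealModel EQ F) (timesRealProj F V) p →ₗ[ℝ] ℝ where
  toFun x := dirDeriv (timesRealModel EQ F) L p (verticalEndomorphism 𝔸 p x).1.2
  map_add' x y := by
    rw [map_add]; exact map_add _ (verticalEndomorphism 𝔸 p x).1.2 _
  map_smul' c x := by
    rw [map_smul]; exact map_smul _ c (verticalEndomorphism 𝔸 p x).1.2

/-- The Lagrangian contact section `η_L = 𝒱^s - Θ_L`. -/
def lagrangianContactForm (𝔸 : LieAlgebroid EQ F V) :
    𝔸.ProlongationForm (timesRealModel EQ F) (timesRealProj F V) 1 :=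
  LieAlgebroid.oneForm fun p ↦ sComponent 𝔸 p - poincareCartan L 𝔸 p

/-- The Liouville `1`-section `Θ(a, v) = b(a)` at the point `(b, s)` of `V* × ℝ`. -/
def liouville (𝔸 : LieAlgebroid EQ F V) (p : TotalSpace (F →L[ℝ] ℝ) (fun q ↦ V q →L[ℝ] ℝ) × ℝ) :
    𝔸.Prolongation (timesRealModel EQ (F →L[ℝ] ℝ))
      (timesRealProj (F →L[ℝ] ℝ) (fun q ↦ V q →L[ℝ] ℝ)) p →ₗ[ℝ] ℝ where
  toFun x := p.1.snd x.1.1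
  map_add' _ _ := p.1.snd.map_add _ _
  map_smul' _ _ := p.1.snd.map_smul _ _

/-- The canonical contact section `η = 𝒱^s - Θ`. -/
def canonicalContactForm (𝔸 : LieAlgebroid EQ F V) :
    𝔸.ProlongationForm (timesRealModel EQ (F →L[ℝ] ℝ))
      (timesRealProj (F →L[ℝ] ℝ) (fun q ↦ V q →L[ℝ] ℝ)) 1 :=
  LieAlgebroid.oneForm fun p ↦ sComponent 𝔸 p - liouville 𝔸 p

end contact
end

/-! The Legendre map `Leg` covers the identity of `Q` and preserves `s`, so `(a, v) ↦ (a, T Leg v)`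
is compatible with every ingredient of the bracket, and pullback of forms should commute with the
Koszul formula. The obstacle is that the exterior derivative is evaluated on chosen extensions of
its arguments to local sections, while naturality is visible only for sections related by `Leg`. Two
facts close this gap.

Tensoriality: the Koszul formula depends only on the values of the sections at the point. In local
coordinates the bracket of two sections is the flat commutator of their coordinate functions plus a
term in their values (`prolongationBracket_eq`). The product rule produces derivatives of the
coordinates of the sections; these cancel against the flat commutators by a sign identity for
alternating maps (`AlternatingMap.sum_update_removeNth_add_sum_cons_eq_zero`), which yields
`koszul_eq_structureTerms` and `koszul_congr`. For the bracket to stay inside the prolongation, the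
anchor must be a homomorphism of brackets. This is no axiom here; it follows from the Jacobi
identity and the Leibniz rule (`anchor_bracket`).

Regularity: a vector killed by `T Leg` is vertical, and on vertical vectors `T Leg` is the fibre
Hessian of `L`. Hence `T Leg` is invertible at every point (`isInvertible_mfderiv_legendre`). Each
section on the dual side then lifts to a related section (`legendrePullback`), lifting respects
brackets (`prolongedLegendre_prolongationBracket`), and on lifted sections the two Koszul formulas
agree term by term (`koszul_pullbackForm_legendrePullback`). Tensoriality carries the equality over
to arbitrary extensions.

For the contact sections, `Θ` at `Leg(b, s)` takes on `a` the derivative of `L` along `b + ta`,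
which is `a^V(L)`. So `η` pulls back to `η_L`, and the identity for the differentials is the
morphism property applied to the smooth form `η`. -/

set_option linter.unusedSectionVars false

/-! ### Tangent vectors and the Lie bracket of vector fields in a chart. -/

section tangentCoordinates

variable {EP : Type*} [NormedAddCommGroup EP] [NormedSpace ℝ EP]
  {HP : Type*} [TopologicalSpace HP] (J : ModelWithCorners ℝ EP HP)
  {P : Type*} [TopologicalSpace P] [ChartedSpace HP P]

/-- The coordinates of a tangent vector at `p` in the preferred chart at `p₀`. -/
noncomputable def tangentCoord (p₀ p : P) : TangentSpace J p →L[ℝ] EP :=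
  mfderiv J 𝓘(ℝ, EP) (extChartAt J p₀) p

variable [IsManifold J ∞ P]

theorem trivializationAt_tangent_snd {p₀ p : P} (hp : p ∈ (chartAt HP p₀).source)
    (v : TangentSpace J p) :
    (trivializationAt EP (TangentSpace J) p₀ (⟨p, v⟩ : TangentBundle J P)).2 =
      tangentCoord J p₀ p v := by
  have : IsManifold J 1 P := IsManifold.of_le (n := ∞) (by simp)
  rw [tangentCoord, ← TangentBundle.continuousLinearMapAt_trivializationAt hp]
  rw [Bundle.Trivialization.continuousLinearMapAt_apply, Bundle.Trivialization.linearMapAt_apply,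
    if_pos (by simpa using hp)]

theorem tangentCoord_self (p : P) (v : TangentSpace J p) : tangentCoord J p p v = v := by
  have : IsManifold J 1 P := IsManifold.of_le (n := ∞) (by simp)
  rw [tangentCoord, mfderiv_extChartAt_self]
  rfl

theorem isInvertible_tangentCoord {p₀ p : P} (hp : p ∈ (chartAt HP p₀).source) :
    (tangentCoord J p₀ p).IsInvertible := by
  have : IsManifold J 1 P := IsManifold.of_le (n := ∞) (by simp)
  exact isInvertible_mfderiv_extChartAt (by simpa using hp)

/-- The reference point `p₀` is independent of `f x₀`, so one fixed chart tests smoothness at all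
points of its domain. -/
theorem contMDiffAt_tangent_iff {EN : Type*} [NormedAddCommGroup EN] [NormedSpace ℝ EN]
    {HN : Type*} [TopologicalSpace HN] {JN : ModelWithCorners ℝ EN HN}
    {N : Type*} [TopologicalSpace N] [ChartedSpace HN N] {f : N → P}
    {X : ∀ x, TangentSpace J (f x)} {x₀ : N} {p₀ : P} (hf : ContMDiffAt JN J ∞ f x₀)
    (hp : f x₀ ∈ (chartAt HP p₀).source) :
    ContMDiffAt JN J.tangent ∞ (fun x ↦ (⟨f x, X x⟩ : TangentBundle J P)) x₀ ↔
      ContMDiffAt JN 𝓘(ℝ, EP) ∞ (fun x ↦ tangentCoord J p₀ (f x) (X x)) x₀ := by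
  have : IsManifold J (∞ + 1) P := by simpa using (inferInstance : IsManifold J ∞ P)
  rw [(trivializationAt EP (TangentSpace J) p₀).contMDiffAt_iff (IB := J)
    (by simpa [Trivialization.mem_source] using hp)]
  rw [and_iff_right (by exact hf)]
  refine Filter.EventuallyEq.contMDiffAt_iff ?_
  filter_upwards [hf.continuousAt.preimage_mem_nhds ((chartAt HP p₀).open_source.mem_nhds hp)]
    with x hx
  exact trivializationAt_tangent_snd J hx (X x)

theorem mvfderiv_eq_fderiv [J.Boundaryless] {E' : Type*} [NormedAddCommGroup E']
    [NormedSpace ℝ E'] {p : P} {g : P → E'} (hg : MDifferentiableAt J 𝓘(ℝ, E') g p)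
    (v : TangentSpace J p) :
    mvfderiv J g p v = fderiv ℝ (g ∘ (extChartAt J p).symm) (extChartAt J p p) (v : EP) := by
  have h := congrArg (fun l : EP →L[ℝ] E' ↦ l (v : EP)) hg.mfderiv
  rw [J.range_eq_univ, fderivWithin_univ] at h
  exact h

/-- In the chart at `p` the vector fields become maps into `EP` with the classical bracket formula.
No derivative of the chart appears in the result because the derivative at `p` of the chart at `p`
is the identity. -/
theorem mlieBracket_eq_tangentCoord [J.Boundaryless] {p : P} {X Y : ∀ p : P, TangentSpace J p}
    (hX : MDifferentiableAt J 𝓘(ℝ, EP) (fun p' ↦ tangentCoord J p p' (X p')) p)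
    (hY : MDifferentiableAt J 𝓘(ℝ, EP) (fun p' ↦ tangentCoord J p p' (Y p')) p) :
    VectorField.mlieBracket J X Y p =
      mvfderiv J (fun p' ↦ tangentCoord J p p' (Y p')) p (X p) -
        mvfderiv J (fun p' ↦ tangentCoord J p p' (X p')) p (Y p) := by
  have : IsManifold J 1 P := IsManifold.of_le (n := ∞) (by simp)
  -- The Lie bracket is defined by pulling back along the inverse chart. The inverse of the
  -- derivative of that map is the derivative of the chart, and without boundary this holds on a
  -- full neighbourhood.
  have key : ∀ Z : ∀ p : P, TangentSpace J p,
      VectorField.mpullbackWithin 𝓘(ℝ, EP) J (extChartAt J p).symm Z univ =ᶠ[𝓝 (extChartAt J p p)]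
        (fun p' ↦ tangentCoord J p p' (Z p')) ∘ (extChartAt J p).symm := by
    intro Z
    rw [← J.range_eq_univ]
    filter_upwards [extChartAt_target_mem_nhds (I := J) p] with z hz
    rw [VectorField.mpullbackWithin_apply]
    have h1 := mfderiv_extChartAt_comp_mfderivWithin_extChartAt_symm (I := J) hz
    have h2 := mfderivWithin_extChartAt_symm_comp_mfderiv_extChartAt (I := J) hz
    exact congrArg (fun l : EP →L[ℝ] EP ↦ l (Z ((extChartAt J p).symm z)))
      (ContinuousLinearMap.inverse_eq (M := EP) (M₂ := EP) h2 h1)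
  have hself : ∀ Z : ∀ p : P, TangentSpace J p,
      tangentCoord J p ((extChartAt J p).symm (extChartAt J p p))
        (Z ((extChartAt J p).symm (extChartAt J p p))) = Z p := by
    intro Z
    rw [extChartAt_to_inv]
    exact tangentCoord_self J p (Z p)
  have h1 : ∀ Z : ∀ p : P, TangentSpace J p, VectorField.mpullbackWithin 𝓘(ℝ, EP) J
      (extChartAt J p).symm Z univ (extChartAt J p p) = (Z p : EP) := fun Z ↦
    (key Z).self_of_nhds.trans (hself Z)
  have h2 : (mfderiv J 𝓘(ℝ, EP) (extChartAt J p) p : EP →L[ℝ] EP).inverse = .id ℝ EP :=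
    (congrArg (fun l : EP →L[ℝ] EP ↦ l.inverse) mfderiv_extChartAt_self).trans
      ContinuousLinearMap.inverse_id
  rw [← VectorField.mlieBracketWithin_univ, VectorField.mlieBracketWithin_apply, preimage_univ,
    univ_inter, J.range_eq_univ, mvfderiv_eq_fderiv J hX,
    mvfderiv_eq_fderiv J hY]
  refine (congrArg (fun l : EP →L[ℝ] EP ↦ l _) h2).trans ?_
  have h3 : ∀ (W g : EP → EP) (x v v' : EP), W =ᶠ[𝓝 x] g → v = v' →
      fderivWithin ℝ W univ x v = fderiv ℝ g x v' := by
    rintro W g x v _ h rfl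
    rw [fderivWithin_univ, h.fderiv_eq]
  exact congrArg₂ (fun a b : EP ↦ a - b) (h3 _ _ _ _ _ (key Y) (h1 X)) (h3 _ _ _ _ _ (key X) (h1 Y))

end tangentCoordinates

/-! ### Alternating forms: the cancellation identity and the product rule. -/

section alternating

/-- Here `d i j` stands for the derivative of the `j`-th coordinate function along the `i`-th
section. Moving an entry from slot `j` to the front costs `(-1)^j`; after that, the two terms of the
first sum belonging to a pair of indices are the negatives of the two halves of the commutator term
of that pair. -/
theorem AlternatingMap.sum_update_removeNth_add_sum_cons_eq_zero {K : Type*} [AddCommGroup K]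
    [Module ℝ K] {n : ℕ} (m : K [⋀^Fin (n + 1)]→ₗ[ℝ] ℝ) (c : Fin (n + 2) → K)
    (d : Fin (n + 2) → Fin (n + 2) → K) :
    (∑ i : Fin (n + 2), (-1 : ℝ) ^ (i : ℕ) *
        ∑ j, m (Function.update (i.removeNth c) j (d i (i.succAbove j)))) +
      ∑ i : Fin (n + 1), ∑ j ∈ Finset.Ici i, (-1 : ℝ) ^ ((i : ℕ) + ((j : ℕ) + 1)) *
        m (Fin.cons (d i.castSucc j.succ - d j.succ i.castSucc)
          (j.removeNth (i.castSucc.removeNth c))) = 0 := by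
  simp only [Finset.mul_sum]
  -- Ordered pairs of distinct indices are grouped into unordered pairs `i < j + 1`, the index set
  -- of the second sum.
  rw [Fin.sum_sum_eq_sum_triangle_add, ← Finset.sum_add_distrib]
  refine Finset.sum_eq_zero fun i _ ↦ ?_
  rw [← Finset.sum_add_distrib]
  refine Finset.sum_eq_zero fun j hj ↦ ?_
  rw [Finset.mem_Ici] at hj
  simp only [← Fin.insertNth_removeNth, AlternatingMap.map_insertNth]
  rw [Fin.removeNth_removeNth_eq_swap]
  have H₁ : i.castSucc.succAbove j = j.succ := by simp [Fin.succAbove_of_le_castSucc, hj]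
  have H₂ : j.predAbove i.castSucc = i := by simp [Fin.predAbove_of_le_castSucc, hj]
  have H₃ : j.succ.succAbove i = i.castSucc := by simp [Fin.succAbove_of_castSucc_lt, hj]
  have H₄ : ∀ x y : K, ∀ t, m (Fin.cons (x - y) t) = m (Fin.cons x t) - m (Fin.cons y t) := by
    intro x y t
    have h := m.map_update_sub (Fin.cons x t) 0 x y
    simpa [Fin.update_cons_zero] using h
  simp only [H₁, H₂, H₃, H₄, Fin.val_castSucc, Fin.val_succ]
  change _ * (_ • m (Fin.cons _ _)) + _ * (_ • m (Fin.cons _ _)) + _ = _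
  simp only [pow_add, pow_one, zsmul_eq_mul, Int.cast_pow, Int.cast_neg, Int.cast_one]
  ring

variable {K : Type*} [NormedAddCommGroup K] [NormedSpace ℝ K] [FiniteDimensional ℝ K] {k : ℕ}

theorem AlternatingMap.apply_eq_sum_basis {ι : Type*} [Fintype ι] [DecidableEq ι]
    (b : Module.Basis ι ℝ K) (m : K [⋀^Fin k]→ₗ[ℝ] ℝ) (z : Fin k → K) :
    m z = ∑ r : Fin k → ι, (∏ i, b.repr (z i) (r i)) * m (fun i ↦ b (r i)) := by
  have h : z = fun i ↦ ∑ j, b.repr (z i) j • b j := funext fun i ↦ (b.sum_repr (z i)).symm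
  conv_lhs => rw [h]
  have := m.toMultilinearMap.map_sum (fun i (j : ι) ↦ b.repr (z i) j • b j)
  refine this.trans (Finset.sum_congr rfl fun r _ ↦ ?_)
  exact m.toMultilinearMap.map_smul_univ (fun i ↦ b.repr (z i) (r i)) (fun i ↦ b (r i))

theorem AlternatingMap.continuous_of_finiteDimensional (m : K [⋀^Fin k]→ₗ[ℝ] ℝ) :
    Continuous m := by
  classical
  set b := Module.finBasis ℝ K
  have h : (m : (Fin k → K) → ℝ) = fun z ↦
      ∑ r : Fin k → _, (∏ i, b.repr (z i) (r i)) * m (fun i ↦ b (r i)) :=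
    funext (m.apply_eq_sum_basis b)
  rw [h]
  refine continuous_finsetSum _ fun r _ ↦ Continuous.mul ?_ continuous_const
  refine continuous_finsetProd _ fun i _ ↦ ?_
  exact (LinearMap.continuous_of_finiteDimensional (b.coord (r i))).comp (continuous_apply i)

/-- An alternating map on a finite-dimensional space is continuous. -/
def AlternatingMap.toContinuousOfFiniteDimensional (m : K [⋀^Fin k]→ₗ[ℝ] ℝ) :
    K [⋀^Fin k]→L[ℝ] ℝ :=
  { m with cont := m.continuous_of_finiteDimensional }

variable {EP : Type*} [NormedAddCommGroup EP] [NormedSpace ℝ EP]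
  {HP : Type*} [TopologicalSpace HP] {J : ModelWithCorners ℝ EP HP}
  {P : Type*} [TopologicalSpace P] [ChartedSpace HP P]

theorem mdifferentiableAt_pi_space {ι : Type*} [Fintype ι] {E' : Type*} [NormedAddCommGroup E']
    [NormedSpace ℝ E'] {g : P → ι → E'} {p : P}
    (hg : ∀ i, MDifferentiableAt J 𝓘(ℝ, E') (fun p' ↦ g p' i) p) :
    MDifferentiableAt J 𝓘(ℝ, ι → E') g p := by
  rw [mdifferentiableAt_iff]
  exact ⟨continuousAt_pi.2 fun i ↦ (hg i).continuousAt, differentiableWithinAt_pi.2 fun i ↦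
    (hg i).differentiableWithinAt_writtenInExtChartAt⟩

/-- A form on a finite-dimensional space is determined linearly by its finitely many values on
tuples of basis vectors, so differentiability of these values gives differentiability of the form
itself. -/
theorem MDifferentiableAt.alternatingMap_toContinuous {m : P → K [⋀^Fin k]→ₗ[ℝ] ℝ} {p : P}
    (hm : ∀ z : Fin k → K, MDifferentiableAt J 𝓘(ℝ, ℝ) (fun p' ↦ m p' z) p) :
    MDifferentiableAt J 𝓘(ℝ, K [⋀^Fin k]→L[ℝ] ℝ)
      (fun p' ↦ (m p').toContinuousOfFiniteDimensional) p := by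
  classical
  set b := Module.finBasis ℝ K
  let ev : (K [⋀^Fin k]→L[ℝ] ℝ) →ₗ[ℝ] ((Fin k → Fin (Module.finrank ℝ K)) → ℝ) :=
    { toFun := fun φ r ↦ φ (fun i ↦ b (r i))
      map_add' := fun _ _ ↦ rfl
      map_smul' := fun _ _ ↦ rfl }
  have hev : LinearMap.ker ev = ⊥ := by
    rw [LinearMap.ker_eq_bot]
    intro φ φ' h
    ext z
    have h1 := φ.toAlternatingMap.apply_eq_sum_basis b z
    have h2 := φ'.toAlternatingMap.apply_eq_sum_basis b z
    refine h1.trans (Eq.trans (Finset.sum_congr rfl fun r _ ↦ ?_) h2.symm)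
    exact congrArg (_ * ·) (congrFun h r)
  -- A linear left inverse of the evaluation is continuous, its source being finite-dimensional; it
  -- recovers the form from its values.
  obtain ⟨G, hG⟩ := LinearMap.exists_leftInverse_of_injective ev hev
  have h1 : (fun p' ↦ (m p').toContinuousOfFiniteDimensional) =
      G.toContinuousLinearMap ∘ fun p' ↦ ev (m p').toContinuousOfFiniteDimensional :=
    funext fun p' ↦ (LinearMap.congr_fun hG _).symm
  rw [h1]
  refine (G.toContinuousLinearMap.differentiableAt.mdifferentiableAt).comp p ?_
  exact mdifferentiableAt_pi_space fun r ↦ hm _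

/-- The product rule for a varying form on varying vectors. The first conclusion is needed on its
own for pulled-back forms. -/
theorem mvfderiv_alternatingMap_apply [IsManifold J ∞ P] [J.Boundaryless]
    {m : P → K [⋀^Fin k]→ₗ[ℝ] ℝ} {p : P} {c : Fin k → P → K}
    (hm : ∀ z : Fin k → K, MDifferentiableAt J 𝓘(ℝ, ℝ) (fun p' ↦ m p' z) p)
    (hc : ∀ i, MDifferentiableAt J 𝓘(ℝ, K) (c i) p) :
    MDifferentiableAt J 𝓘(ℝ, ℝ) (fun p' ↦ m p' (fun i ↦ c i p')) p ∧
    ∀ v, mvfderiv J (fun p' ↦ m p' (fun i ↦ c i p')) p v =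
      mvfderiv J (fun p' ↦ m p' (fun i ↦ c i p)) p v +
        ∑ i, m p (Function.update (fun i ↦ c i p) i (mvfderiv J (c i) p v)) := by
  have hm' := MDifferentiableAt.alternatingMap_toContinuous hm
  have h1 : MDifferentiableAt J 𝓘(ℝ, ℝ) (fun p' ↦ m p' (fun i ↦ c i p')) p := by
    have h2 : DifferentiableAt ℝ (fun z : (K [⋀^Fin k]→L[ℝ] ℝ) × (Fin k → K) ↦ z.1 z.2)
        ((m p).toContinuousOfFiniteDimensional, fun i ↦ c i p) := by
      refine DifferentiableAt.continuousAlternatingMap_apply differentiableAt_fst (fun i ↦ ?_)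
      exact (ContinuousLinearMap.proj (R := ℝ) (φ := fun _ : Fin k ↦ K) i ∘L
        ContinuousLinearMap.snd ℝ (K [⋀^Fin k]→L[ℝ] ℝ) (Fin k → K)).differentiableAt
    exact MDifferentiableAt.comp (g := fun z : (K [⋀^Fin k]→L[ℝ] ℝ) × (Fin k → K) ↦ z.1 z.2) p
      h2.mdifferentiableAt (hm'.prodMk_space (mdifferentiableAt_pi_space hc))
  refine ⟨h1, fun v ↦ ?_⟩
  have hself : (extChartAt J p).symm (extChartAt J p p) = p := extChartAt_to_inv p
  have hdiff : ∀ {E' : Type _} [NormedAddCommGroup E'] [NormedSpace ℝ E'] {g : P → E'},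
      MDifferentiableAt J 𝓘(ℝ, E') g p →
      DifferentiableAt ℝ (g ∘ (extChartAt J p).symm) (extChartAt J p p) := by
    intro E' _ _ g hg
    have := hg.differentiableWithinAt_writtenInExtChartAt
    rw [J.range_eq_univ, differentiableWithinAt_univ] at this
    exact this
  rw [mvfderiv_eq_fderiv J h1, mvfderiv_eq_fderiv J (hm _)]
  have h3 := fderiv_continuousAlternatingMap_apply_apply (hdiff hm') (fun i ↦ hdiff (hc i)) v
  refine h3.trans ?_
  simp only [Function.comp_apply, hself]
  congr 1
  · exact (fderiv_continuousAlternatingMap_apply_const_apply (hdiff hm') _ _).symm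
  · refine Finset.sum_congr rfl fun i _ ↦ ?_
    rw [mvfderiv_eq_fderiv J (hc i)]
    rfl

end alternating

/-! ### Coordinates and frames of the prolongation over `W × ℝ`. -/

section prolongationFrame

variable {EQ : Type*} [NormedAddCommGroup EQ] [NormedSpace ℝ EQ]
  {Q : Type*} [TopologicalSpace Q] [ChartedSpace EQ Q] [IsManifold 𝓘(ℝ, EQ) ∞ Q]
  {G : Type*} [NormedAddCommGroup G] [NormedSpace ℝ G]
  {W : Q → Type*} [TopologicalSpace (TotalSpace G W)] [∀ q, AddCommGroup (W q)]
  [∀ q, Module ℝ (W q)] [∀ q, TopologicalSpace (W q)] [FiberBundle G W] [VectorBundle ℝ G W]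
  [ContMDiffVectorBundle ∞ G W 𝓘(ℝ, EQ)]

theorem mem_chartAt_source_timesReal {p₀ p : TotalSpace G W × ℝ} :
    p ∈ (chartAt (ModelProd (ModelProd EQ G) ℝ) p₀).source ↔
      p.1.proj ∈ (trivializationAt G W p₀.1.proj).baseSet ∧
      p.1.proj ∈ (chartAt EQ p₀.1.proj).source := by
  simp only [prodChartedSpace_chartAt, OpenPartialHomeomorph.prod_source, mem_prod,
    FiberBundle.chartedSpace_chartAt, chartAt_self_eq, OpenPartialHomeomorph.refl_source, mem_univ,
    and_true]
  simp [Trivialization.mem_source]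
  intro h
  rw [Trivialization.coe_fst _ ((trivializationAt G W p₀.1.proj).mem_source.2 h)]

theorem contMDiff_timesRealProj :
    ContMDiff (timesRealModel EQ G) 𝓘(ℝ, EQ) ∞ (timesRealProj G W) :=
  (contMDiff_proj W).comp contMDiff_fst

/-- In the bundle chart of `W × ℝ` and the chart of `Q` below it, the projection is the linear
projection onto `EQ`. -/
theorem tangentCoord_mfderiv_timesRealProj {p₀ p : TotalSpace G W × ℝ}
    (hp : p ∈ (chartAt (ModelProd (ModelProd EQ G) ℝ) p₀).source)
    (v : TangentSpace (timesRealModel EQ G) p) :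
    tangentCoord 𝓘(ℝ, EQ) p₀.1.proj p.1.proj
      (mfderiv (timesRealModel EQ G) 𝓘(ℝ, EQ) (timesRealProj G W) p v) =
      (tangentCoord (timesRealModel EQ G) p₀ p v).1.1 := by
  have : IsManifold 𝓘(ℝ, EQ) 1 Q := IsManifold.of_le (n := ∞) (by simp)
  have : IsManifold (timesRealModel EQ G) 1 (TotalSpace G W × ℝ) :=
    IsManifold.of_le (n := ∞) (by simp)
  have hp' := (mem_chartAt_source_timesReal (EQ := EQ)).1 hp
  have h1 : MDifferentiableAt 𝓘(ℝ, EQ) 𝓘(ℝ, EQ) (extChartAt 𝓘(ℝ, EQ) p₀.1.proj) p.1.proj :=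
    mdifferentiableAt_extChartAt hp'.2
  have h2 : MDifferentiableAt (timesRealModel EQ G) 𝓘(ℝ, EQ) (timesRealProj G W) p :=
    contMDiff_timesRealProj.mdifferentiableAt (by simp)
  have h3 : MDifferentiableAt (timesRealModel EQ G) 𝓘(ℝ, (EQ × G) × ℝ)
      (extChartAt (timesRealModel EQ G) p₀) p := mdifferentiableAt_extChartAt hp
  set l : ((EQ × G) × ℝ) →L[ℝ] EQ := (ContinuousLinearMap.fst ℝ EQ G).comp
    (ContinuousLinearMap.fst ℝ (EQ × G) ℝ)
  have h4 : (extChartAt 𝓘(ℝ, EQ) p₀.1.proj) ∘ timesRealProj G W =ᶠ[𝓝 p]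
      l ∘ extChartAt (timesRealModel EQ G) p₀ := by
    filter_upwards [(chartAt (ModelProd (ModelProd EQ G) ℝ) p₀).open_source.mem_nhds hp] with x hx
    have hx' := (mem_chartAt_source_timesReal (EQ := EQ)).1 hx
    simp only [Function.comp_apply, l, extChartAt_prod, FiberBundle.extChartAt]
    simp [Trivialization.coe_fst _ ((trivializationAt G W p₀.1.proj).mem_source.2 hx'.1)]
  have h5 := mfderiv_comp_apply p h1 h2 v
  have h6 := mfderiv_comp_apply p l.mdifferentiableAt h3 v
  rw [h4.mfderiv_eq] at h5
  refine h5.symm.trans (h6.trans ?_)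
  rw [l.mfderiv_eq]
  rfl

variable {F : Type*} [NormedAddCommGroup F] [NormedSpace ℝ F]
  {V : Q → Type*} [TopologicalSpace (TotalSpace F V)] [∀ q, AddCommGroup (V q)]
  [∀ q, Module ℝ (V q)] [∀ q, TopologicalSpace (V q)] [FiberBundle F V] [VectorBundle ℝ F V]
  [ContMDiffVectorBundle ∞ F V 𝓘(ℝ, EQ)]

variable (F) in
/-- The coordinates of `a : V q` in the preferred trivialization at `q₀`. -/
noncomputable def fibreCoord (q₀ q : Q) : V q →L[ℝ] F :=
  (trivializationAt F V q₀).continuousLinearMapAt ℝ q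

theorem fibreCoord_apply {q₀ q : Q} (hq : q ∈ (trivializationAt F V q₀).baseSet) (a : V q) :
    fibreCoord F q₀ q a = (trivializationAt F V q₀ ⟨q, a⟩).2 := by
  rw [fibreCoord, Trivialization.continuousLinearMapAt_apply, Trivialization.linearMapAt_apply,
    if_pos hq]

theorem contMDiffAt_fibre_iff {EN : Type*} [NormedAddCommGroup EN] [NormedSpace ℝ EN]
    {HN : Type*} [TopologicalSpace HN] {JN : ModelWithCorners ℝ EN HN}
    {N : Type*} [TopologicalSpace N] [ChartedSpace HN N] {g : N → Q}
    {a : ∀ x, V (g x)} {x₀ : N} {q₀ : Q} (hg : ContMDiffAt JN 𝓘(ℝ, EQ) ∞ g x₀)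
    (hq : g x₀ ∈ (trivializationAt F V q₀).baseSet) :
    ContMDiffAt JN (𝓘(ℝ, EQ).prod 𝓘(ℝ, F)) ∞ (fun x ↦ (⟨g x, a x⟩ : TotalSpace F V)) x₀ ↔
      ContMDiffAt JN 𝓘(ℝ, F) ∞ (fun x ↦ fibreCoord F q₀ (g x) (a x)) x₀ := by
  rw [(trivializationAt F V q₀).contMDiffAt_iff (IB := 𝓘(ℝ, EQ))
    (by simpa [Trivialization.mem_source] using hq), and_iff_right (by exact hg)]
  refine Filter.EventuallyEq.contMDiffAt_iff ?_
  filter_upwards [hg.continuousAt.preimage_mem_nhds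
    ((trivializationAt F V q₀).open_baseSet.mem_nhds hq)] with x hx
  exact (fibreCoord_apply hx (a x)).symm

namespace LieAlgebroid

variable (𝔸 : LieAlgebroid EQ F V)

/-- The anchor at `q`, read in the preferred trivialization and the preferred chart at `q₀`. -/
noncomputable def anchorCoord (q₀ q : Q) : F →ₗ[ℝ] EQ :=
  (tangentCoord 𝓘(ℝ, EQ) q₀ q).toLinearMap ∘ₗ 𝔸.anchor q ∘ₗ
    ((trivializationAt F V q₀).symmL ℝ q).toLinearMap

theorem anchorCoord_fibreCoord {q₀ q : Q} (hq : q ∈ (trivializationAt F V q₀).baseSet) (a : V q) :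
    𝔸.anchorCoord q₀ q (fibreCoord F q₀ q a) = tangentCoord 𝓘(ℝ, EQ) q₀ q (𝔸.anchor q a) := by
  change tangentCoord 𝓘(ℝ, EQ) q₀ q (𝔸.anchor q ((trivializationAt F V q₀).symmL ℝ q
    ((trivializationAt F V q₀).continuousLinearMapAt ℝ q a))) = _
  rw [Trivialization.symmL_continuousLinearMapAt _ hq]

theorem _root_.fibreCoord_symmL {q₀ q : Q} (hq : q ∈ (trivializationAt F V q₀).baseSet) (z : F) :
    fibreCoord F q₀ q ((trivializationAt F V q₀).symmL ℝ q z) = z :=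
  Trivialization.continuousLinearMapAt_symmL _ hq z

theorem contMDiffAt_anchorCoord {EN : Type*} [NormedAddCommGroup EN] [NormedSpace ℝ EN]
    {HN : Type*} [TopologicalSpace HN] {JN : ModelWithCorners ℝ EN HN}
    {N : Type*} [TopologicalSpace N] [ChartedSpace HN N] {g : N → Q} {z : N → F} {x₀ : N} {q₀ : Q}
    (hg : ContMDiffAt JN 𝓘(ℝ, EQ) ∞ g x₀) (hz : ContMDiffAt JN 𝓘(ℝ, F) ∞ z x₀)
    (hq : g x₀ ∈ (trivializationAt F V q₀).baseSet) (hq' : g x₀ ∈ (chartAt EQ q₀).source) :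
    ContMDiffAt JN 𝓘(ℝ, EQ) ∞ (fun x ↦ 𝔸.anchorCoord q₀ (g x) (z x)) x₀ := by
  refine (contMDiffAt_tangent_iff 𝓘(ℝ, EQ) hg hq').1 ?_
  refine 𝔸.contMDiff_anchor.contMDiffAt.comp x₀ (f := fun x ↦
    (⟨g x, (trivializationAt F V q₀).symmL ℝ (g x) (z x)⟩ : TotalSpace F V)) ?_
  rw [contMDiffAt_fibre_iff hg hq]
  refine hz.congr_of_eventuallyEq ?_
  filter_upwards [hg.continuousAt.preimage_mem_nhds
    ((trivializationAt F V q₀).open_baseSet.mem_nhds hq)] with x hx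
  exact fibreCoord_symmL hx _

/-- The coordinates of an element of the prolongation over `W × ℝ`. -/
noncomputable def prolongCoord (p₀ p : TotalSpace G W × ℝ) :
    𝔸.Prolongation (timesRealModel EQ G) (timesRealProj G W) p →ₗ[ℝ] F × ((EQ × G) × ℝ) :=
  ((fibreCoord F p₀.1.proj p.1.proj).toLinearMap.prodMap
    (tangentCoord (timesRealModel EQ G) p₀ p).toLinearMap) ∘ₗ Submodule.subtype _

/-- The element of the prolongation over `W × ℝ` with a given `V`-component and given vertical
components. -/
noncomputable def prolongFrameAux (p₀ p : TotalSpace G W × ℝ) :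
    F × ((EQ × G) × ℝ) →ₗ[ℝ] V p.1.proj × TangentSpace (timesRealModel EQ G) p :=
  LinearMap.prod
    (((trivializationAt F V p₀.1.proj).symmL ℝ p.1.proj).toLinearMap ∘ₗ LinearMap.fst ℝ _ _)
    ((tangentCoord (timesRealModel EQ G) p₀ p).inverse.toLinearMap ∘ₗ
      ((𝔸.anchorCoord p₀.1.proj p.1.proj ∘ₗ LinearMap.fst ℝ _ _).prod
        (LinearMap.snd ℝ EQ G ∘ₗ LinearMap.fst ℝ _ _ ∘ₗ LinearMap.snd ℝ _ _)).prod
        (LinearMap.snd ℝ (EQ × G) ℝ ∘ₗ LinearMap.snd ℝ _ _))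

theorem tangentCoord_prolongFrameAux {p₀ p : TotalSpace G W × ℝ}
    (hp : p ∈ (chartAt (ModelProd (ModelProd EQ G) ℝ) p₀).source) (z : F × ((EQ × G) × ℝ)) :
    tangentCoord (timesRealModel EQ G) p₀ p (𝔸.prolongFrameAux p₀ p z).2 =
      ((𝔸.anchorCoord p₀.1.proj p.1.proj z.1, z.2.1.2), z.2.2) := by
  obtain ⟨e, he⟩ := isInvertible_tangentCoord (timesRealModel EQ G) hp
  change tangentCoord (timesRealModel EQ G) p₀ p ((tangentCoord (timesRealModel EQ G) p₀ p).inverse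
    ((𝔸.anchorCoord p₀.1.proj p.1.proj z.1, z.2.1.2), z.2.2)) = _
  rw [← he, ContinuousLinearMap.inverse_equiv]
  exact e.apply_symm_apply _

/-- The `EQ`-entry of `z` is discarded and replaced by the anchor of its `F`-entry. This is the
condition `ρ(a) = Tπ(v)` read in coordinates. -/
theorem prolongFrameAux_mem {p₀ p : TotalSpace G W × ℝ}
    (hp : p ∈ (chartAt (ModelProd (ModelProd EQ G) ℝ) p₀).source) (z : F × ((EQ × G) × ℝ)) :
    𝔸.prolongFrameAux p₀ p z ∈
      𝔸.Prolongation (timesRealModel EQ G) (timesRealProj G W) p := by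
  obtain ⟨e, he⟩ := isInvertible_tangentCoord 𝓘(ℝ, EQ)
    ((mem_chartAt_source_timesReal (EQ := EQ)).1 hp).2
  have hinj : Function.Injective (tangentCoord 𝓘(ℝ, EQ) p₀.1.proj p.1.proj) := by
    rw [← he]; exact e.injective
  exact hinj ((congrArg (fun u : (EQ × G) × ℝ ↦ u.1.1) (𝔸.tangentCoord_prolongFrameAux hp z)).symm.trans
    (tangentCoord_mfderiv_timesRealProj hp _).symm)

open Classical in
/-- The linear parametrization of the fibres of the prolongation over `W × ℝ` near `p₀`; its
values on constant vectors are smooth sections. -/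
noncomputable def prolongFrame (p₀ p : TotalSpace G W × ℝ) : F × ((EQ × G) × ℝ) →ₗ[ℝ]
    𝔸.Prolongation (timesRealModel EQ G) (timesRealProj G W) p :=
  if hp : p ∈ (chartAt (ModelProd (ModelProd EQ G) ℝ) p₀).source then
    (𝔸.prolongFrameAux p₀ p).codRestrict _ (𝔸.prolongFrameAux_mem hp) else 0

variable (EQ F G V W) in
/-- The domain of the coordinates of the prolongation over `W × ℝ` at `p₀`. -/
def prolongDomain (p₀ : TotalSpace G W × ℝ) : Set (TotalSpace G W × ℝ) :=
  (chartAt (ModelProd (ModelProd EQ G) ℝ) p₀).source ∩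
    timesRealProj G W ⁻¹' (trivializationAt F V p₀.1.proj).baseSet

theorem isOpen_prolongDomain (p₀ : TotalSpace G W × ℝ) : IsOpen (prolongDomain EQ G W F V p₀) :=
  (chartAt (ModelProd (ModelProd EQ G) ℝ) p₀).open_source.inter
    ((trivializationAt F V p₀.1.proj).open_baseSet.preimage
      (contMDiff_timesRealProj (EQ := EQ)).continuous)

theorem mem_prolongDomain_self (p₀ : TotalSpace G W × ℝ) : p₀ ∈ prolongDomain EQ G W F V p₀ :=
  ⟨mem_chart_source _ _, FiberBundle.mem_baseSet_trivializationAt' p₀.1.proj⟩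

theorem coe_prolongFrame {p₀ p : TotalSpace G W × ℝ} (hp : p ∈ prolongDomain EQ G W F V p₀)
    (z : F × ((EQ × G) × ℝ)) :
    (𝔸.prolongFrame p₀ p z : V p.1.proj × TangentSpace (timesRealModel EQ G) p) =
      𝔸.prolongFrameAux p₀ p z := by
  rw [prolongFrame, dif_pos hp.1]
  rfl

/-- The coordinates are redundant: the defining condition recovers the `EQ`-entry from the
`F`-entry. Thus `prolongFrame` is only a one-sided inverse of `prolongCoord`, and a complement of
the redundant directions never has to be chosen. -/
theorem prolongFrame_prolongCoord {p₀ p : TotalSpace G W × ℝ}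
    (hp : p ∈ prolongDomain EQ G W F V p₀)
    (w : 𝔸.Prolongation (timesRealModel EQ G) (timesRealProj G W) p) :
    𝔸.prolongFrame p₀ p (𝔸.prolongCoord p₀ p w) = w := by
  refine Subtype.ext ?_
  rw [coe_prolongFrame 𝔸 hp]
  refine Prod.ext (Trivialization.symmL_continuousLinearMapAt _ hp.2 _) ?_
  obtain ⟨e, he⟩ := isInvertible_tangentCoord (timesRealModel EQ G) hp.1
  have hinj : Function.Injective (tangentCoord (timesRealModel EQ G) p₀ p) := by
    rw [← he]; exact e.injective
  refine hinj ?_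
  rw [tangentCoord_prolongFrameAux 𝔸 hp.1]
  refine Prod.ext (Prod.ext ?_ rfl) rfl
  refine (𝔸.anchorCoord_fibreCoord hp.2 w.1.1).trans ?_
  refine Eq.trans ?_ (tangentCoord_mfderiv_timesRealProj hp.1 w.1.2)
  exact congrArg _ w.2

section along

variable {EN : Type*} [NormedAddCommGroup EN] [NormedSpace ℝ EN]
  {HN : Type*} [TopologicalSpace HN] {JN : ModelWithCorners ℝ EN HN}
  {N : Type*} [TopologicalSpace N] [ChartedSpace HN N] {f : N → TotalSpace G W × ℝ}

theorem contMDiffAt_prolongCoord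
    {σ : ∀ x : N, 𝔸.Prolongation (timesRealModel EQ G) (timesRealProj G W) (f x)} {U : Set N}
    (hU : IsOpen U) {x : N} (hx : x ∈ U) (hf : ContMDiffAt JN (timesRealModel EQ G) ∞ f x)
    (hσ : 𝔸.SmoothAlongOn (timesRealModel EQ G) (timesRealProj G W) JN f σ U)
    {p₀ : TotalSpace G W × ℝ} (hp : f x ∈ prolongDomain EQ G W F V p₀) :
    ContMDiffAt JN 𝓘(ℝ, F × ((EQ × G) × ℝ)) ∞ (fun y ↦ 𝔸.prolongCoord p₀ (f y) (σ y)) x := by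
  refine ContMDiffAt.prodMk_space ?_ ?_
  · exact (contMDiffAt_fibre_iff (EQ := EQ) (contMDiff_timesRealProj.contMDiffAt.comp x hf) hp.2).1
      (hσ.1.contMDiffAt (hU.mem_nhds hx))
  · exact (contMDiffAt_tangent_iff _ hf hp.1).1 (hσ.2.contMDiffAt (hU.mem_nhds hx))

theorem smoothAlongOn_prolongFrame {U : Set N} (hU : IsOpen U) {c : N → F × ((EQ × G) × ℝ)}
    (hf : ContMDiffOn JN (timesRealModel EQ G) ∞ f U)
    (hc : ContMDiffOn JN 𝓘(ℝ, F × ((EQ × G) × ℝ)) ∞ c U) {p₀ : TotalSpace G W × ℝ}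
    (hp : ∀ x ∈ U, f x ∈ prolongDomain EQ G W F V p₀) :
    𝔸.SmoothAlongOn (timesRealModel EQ G) (timesRealProj G W) JN f
      (fun x ↦ 𝔸.prolongFrame p₀ (f x) (c x)) U := by
  constructor
  · intro x hx
    refine ContMDiffAt.contMDiffWithinAt ?_
    have hfx := hf.contMDiffAt (hU.mem_nhds hx)
    have hg := contMDiff_timesRealProj.contMDiffAt.comp x hfx
    refine (contMDiffAt_fibre_iff (EQ := EQ) hg (hp x hx).2).2 ?_
    have hcx := hc.contMDiffAt (hU.mem_nhds hx)
    refine ((contDiff_fst.contMDiff.contMDiffAt).comp x hcx).congr_of_eventuallyEq ?_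
    filter_upwards [hU.mem_nhds hx] with y hy
    rw [coe_prolongFrame 𝔸 (hp y hy)]
    exact fibreCoord_symmL (hp y hy).2 _
  · intro x hx
    refine ContMDiffAt.contMDiffWithinAt ?_
    have hfx := hf.contMDiffAt (hU.mem_nhds hx)
    have hg := contMDiff_timesRealProj.contMDiffAt.comp x hfx
    have hcx := hc.contMDiffAt (hU.mem_nhds hx)
    refine (contMDiffAt_tangent_iff _ hfx (hp x hx).1).2 ?_
    have h1 : ContMDiffAt JN 𝓘(ℝ, (EQ × G) × ℝ) ∞ (fun y ↦
        ((𝔸.anchorCoord p₀.1.proj (f y).1.proj (c y).1, (c y).2.1.2), (c y).2.2)) x := by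
      refine ContMDiffAt.prodMk_space (ContMDiffAt.prodMk_space ?_ ?_) ?_
      · exact 𝔸.contMDiffAt_anchorCoord hg ((contDiff_fst.contMDiff.contMDiffAt).comp x hcx)
          (hp x hx).2 ((mem_chartAt_source_timesReal (EQ := EQ)).1 (hp x hx).1).2
      · exact ((contDiff_snd.comp (contDiff_fst.comp contDiff_snd)).contMDiff.contMDiffAt).comp x hcx
      · exact ((contDiff_snd.comp contDiff_snd).contMDiff.contMDiffAt).comp x hcx
    refine h1.congr_of_eventuallyEq ?_
    filter_upwards [hU.mem_nhds hx] with y hy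
    rw [coe_prolongFrame 𝔸 (hp y hy)]
    exact tangentCoord_prolongFrameAux 𝔸 (hp y hy).1 _

end along

theorem exists_smooth_section {p : TotalSpace G W × ℝ}
    (w : 𝔸.Prolongation (timesRealModel EQ G) (timesRealProj G W) p) :
    ∃ σ : ∀ p' : TotalSpace G W × ℝ,
      𝔸.Prolongation (timesRealModel EQ G) (timesRealProj G W) p', σ p = w ∧
      ∃ U ∈ 𝓝 p, IsOpen U ∧ 𝔸.SmoothSectionOn (timesRealModel EQ G) (timesRealProj G W) σ U :=
  ⟨fun p' ↦ 𝔸.prolongFrame p p' (𝔸.prolongCoord p p w),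
    𝔸.prolongFrame_prolongCoord (mem_prolongDomain_self p) w, prolongDomain EQ G W F V p,
    (isOpen_prolongDomain p).mem_nhds (mem_prolongDomain_self p), isOpen_prolongDomain p,
    𝔸.smoothAlongOn_prolongFrame (isOpen_prolongDomain p) contMDiffOn_id contMDiffOn_const
      (fun _ h ↦ h)⟩

/-- Freezing the coordinates of `w` in `prolongFrame p` gives a smooth section through `w`, so the
default value in `sectionThrough` never occurs over `W × ℝ`. -/
theorem sectionThrough_spec {p : TotalSpace G W × ℝ}
    (w : 𝔸.Prolongation (timesRealModel EQ G) (timesRealProj G W) p) :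
    𝔸.sectionThrough (timesRealModel EQ G) (timesRealProj G W) w p = w ∧
      ∃ U ∈ 𝓝 p, IsOpen U ∧ 𝔸.SmoothSectionOn (timesRealModel EQ G) (timesRealProj G W)
        (𝔸.sectionThrough (timesRealModel EQ G) (timesRealProj G W) w) U := by
  have h := 𝔸.exists_smooth_section w
  rw [sectionThrough, dif_pos h]
  exact h.choose_spec

end LieAlgebroid

end prolongationFrame

/-! ### The anchor is a homomorphism of brackets. -/

section anchor

theorem ContMDiffOn.dirDeriv_vectorField {EP : Type*} [NormedAddCommGroup EP] [NormedSpace ℝ EP]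
    {HP : Type*} [TopologicalSpace HP] {J : ModelWithCorners ℝ EP HP}
    {P : Type*} [TopologicalSpace P] [ChartedSpace HP P] [IsManifold J ∞ P] {f : P → ℝ}
    (hf : ContMDiff J 𝓘(ℝ, ℝ) ∞ f) {X : ∀ p : P, TangentSpace J p} {U : Set P}
    (hX : ContMDiffOn J J.tangent ∞ (fun p ↦ (⟨p, X p⟩ : TangentBundle J P)) U) :
    ContMDiffOn J 𝓘(ℝ, ℝ) ∞ (fun p ↦ dirDeriv J f p (X p)) U :=
  (contMDiff_snd_tangentBundle_modelSpace ℝ 𝓘(ℝ, ℝ)).comp_contMDiffOn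
    ((hf.contMDiff_tangentMap (m := ∞) (by simp)).comp_contMDiffOn hX)

variable {EQ : Type*} [NormedAddCommGroup EQ] [NormedSpace ℝ EQ]
  {Q : Type*} [TopologicalSpace Q] [ChartedSpace EQ Q] [IsManifold 𝓘(ℝ, EQ) ∞ Q]
  {F : Type*} [NormedAddCommGroup F] [NormedSpace ℝ F]
  {V : Q → Type*} [TopologicalSpace (TotalSpace F V)] [∀ q, AddCommGroup (V q)]
  [∀ q, Module ℝ (V q)] [∀ q, TopologicalSpace (V q)] [FiberBundle F V] [VectorBundle ℝ F V]

namespace LieAlgebroid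

variable (𝔸 : LieAlgebroid EQ F V)

theorem contMDiff_anchor_section (s : Cₛ^∞⟮𝓘(ℝ, EQ); F, V⟯) :
    ContMDiff 𝓘(ℝ, EQ) 𝓘(ℝ, EQ).tangent ∞
      (fun q ↦ (⟨q, 𝔸.anchor q (s q)⟩ : TangentBundle 𝓘(ℝ, EQ) Q)) :=
  𝔸.contMDiff_anchor.comp s.contMDiff

/-- The derivative `ρ(s) f` of a smooth function `f` along the anchor of the section `s`. -/
noncomputable def anchorDeriv (s : Cₛ^∞⟮𝓘(ℝ, EQ); F, V⟯) (f : C^∞⟮𝓘(ℝ, EQ), Q; ℝ⟯) :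
    C^∞⟮𝓘(ℝ, EQ), Q; ℝ⟯ :=
  ⟨fun q ↦ dirDeriv 𝓘(ℝ, EQ) f q (𝔸.anchor q (s q)), by
    rw [← contMDiffOn_univ]
    exact ContMDiffOn.dirDeriv_vectorField f.contMDiff (𝔸.contMDiff_anchor_section s).contMDiffOn⟩

theorem bracket_smoothFunSMul (s u : Cₛ^∞⟮𝓘(ℝ, EQ); F, V⟯) (f : C^∞⟮𝓘(ℝ, EQ), Q; ℝ⟯) :
    𝔸.bracket s (smoothFunSMul f u) =
      smoothFunSMul f (𝔸.bracket s u) + smoothFunSMul (𝔸.anchorDeriv s f) u :=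
  ContMDiffSection.ext fun q ↦ 𝔸.leibniz f s u q

theorem bracket_skew (s t : Cₛ^∞⟮𝓘(ℝ, EQ); F, V⟯) : 𝔸.bracket s t = -𝔸.bracket t s := by
  have h := 𝔸.bracket_self (s + t)
  simp only [map_add, LinearMap.add_apply, 𝔸.bracket_self, zero_add, add_zero] at h
  exact eq_neg_of_add_eq_zero_right h

/-- Expand the Jacobi identity for `s, t, fu` by the Leibniz rule and subtract `f` times the one for
`s, t, u`: only the second-order terms in `f` survive, multiplied by `u`. -/
theorem anchorDeriv_bracket_smul (s t u : Cₛ^∞⟮𝓘(ℝ, EQ); F, V⟯) (f : C^∞⟮𝓘(ℝ, EQ), Q; ℝ⟯)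
    (q : Q) :
    (𝔸.anchorDeriv (𝔸.bracket s t) f q - (𝔸.anchorDeriv s (𝔸.anchorDeriv t f) q -
      𝔸.anchorDeriv t (𝔸.anchorDeriv s f) q)) • u q = 0 := by
  have h1 := 𝔸.jacobi s t (smoothFunSMul f u)
  have h0 := 𝔸.jacobi s t u
  -- The Leibniz rule is an axiom in the second slot only, so `fu` is moved there.
  rw [𝔸.bracket_skew (smoothFunSMul f u) s, 𝔸.bracket_skew (smoothFunSMul f u) (𝔸.bracket s t)] at h1
  rw [𝔸.bracket_skew u s, 𝔸.bracket_skew u (𝔸.bracket s t)] at h0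
  simp only [bracket_smoothFunSMul, map_add, map_neg] at h1 h0
  have h1q := congrArg (fun σ : Cₛ^∞⟮𝓘(ℝ, EQ); F, V⟯ ↦ σ q) h1
  have h0q := congrArg (fun σ : Cₛ^∞⟮𝓘(ℝ, EQ); F, V⟯ ↦ σ q) h0
  have hs : ∀ (g : C^∞⟮𝓘(ℝ, EQ), Q; ℝ⟯) (σ : Cₛ^∞⟮𝓘(ℝ, EQ); F, V⟯),
    smoothFunSMul g σ q = g q • σ q := fun _ _ ↦ rfl
  simp only [ContMDiffSection.coe_add, ContMDiffSection.coe_neg, ContMDiffSection.coe_zero,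
    Pi.add_apply, Pi.neg_apply, Pi.zero_apply, hs] at h1q h0q
  have h2 := congrArg (fun x ↦ f q • x) h0q
  simp only [smul_add, smul_neg, smul_zero] at h2
  rw [sub_smul, sub_smul, ← neg_eq_zero, ← sub_eq_zero_of_eq (h1q.trans h2.symm)]
  abel

/-- Cut-off coordinate functions serve as test functions. The formula is needed on a neighbourhood
of `q` and not only at `q`, because `df` is differentiated again. -/
theorem _root_.exists_contMDiffMap_dirDeriv_eq [FiniteDimensional ℝ EQ] [T2Space Q] (q : Q)
    (l : EQ →L[ℝ] ℝ) : ∃ f : C^∞⟮𝓘(ℝ, EQ), Q; ℝ⟯, ∀ᶠ q' in 𝓝 q, ∀ v,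
      dirDeriv 𝓘(ℝ, EQ) f q' v = l (tangentCoord 𝓘(ℝ, EQ) q q' v) := by
  obtain ⟨χ⟩ : Nonempty (SmoothBumpFunction 𝓘(ℝ, EQ) q) := inferInstance
  have : IsManifold 𝓘(ℝ, EQ) 1 Q := IsManifold.of_le (n := ∞) (by simp)
  have h1 : ContMDiffOn 𝓘(ℝ, EQ) 𝓘(ℝ, ℝ) ∞ (l ∘ extChartAt 𝓘(ℝ, EQ) q) (chartAt EQ q).source :=
    l.contDiff.contMDiff.comp_contMDiffOn contMDiffOn_extChartAt
  refine ⟨⟨_, χ.contMDiff_smul h1⟩, ?_⟩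
  filter_upwards [χ.eventuallyEq_one.eventuallyEq_nhds,
    (chartAt EQ q).open_source.mem_nhds (mem_chart_source EQ q)] with q' h2 h3 v
  have h4 : (fun x ↦ χ x • (l ∘ extChartAt 𝓘(ℝ, EQ) q) x) =ᶠ[𝓝 q'] l ∘ extChartAt 𝓘(ℝ, EQ) q := by
    filter_upwards [h2] with x hx
    rw [hx, Pi.one_apply, one_smul]
  change mfderiv 𝓘(ℝ, EQ) 𝓘(ℝ, ℝ) (fun x ↦ χ x • (l ∘ extChartAt 𝓘(ℝ, EQ) q) x) q' v = _
  have h5 : MDifferentiableAt 𝓘(ℝ, EQ) 𝓘(ℝ, EQ) (extChartAt 𝓘(ℝ, EQ) q) q' :=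
    mdifferentiableAt_extChartAt h3
  have h6 := mfderiv_comp_apply q' l.mdifferentiableAt h5 v
  rw [h4.mfderiv_eq]
  refine h6.trans ?_
  rw [l.mfderiv_eq]
  rfl

theorem anchor_eq_zero_of_subsingleton [Subsingleton F] (q : Q) (a : V q) : 𝔸.anchor q a = 0 := by
  have h : a = 0 := ((trivializationAt F V q).continuousLinearEquivAt ℝ q
    (FiberBundle.mem_baseSet_trivializationAt' q)).injective (Subsingleton.elim _ _)
  rw [h, map_zero]

theorem contMDiffAt_tangentCoord_anchor_section (s : Cₛ^∞⟮𝓘(ℝ, EQ); F, V⟯) (q : Q) :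
    ContMDiffAt 𝓘(ℝ, EQ) 𝓘(ℝ, EQ) ∞
      (fun q' ↦ tangentCoord 𝓘(ℝ, EQ) q q' (𝔸.anchor q' (s q'))) q :=
  (contMDiffAt_tangent_iff 𝓘(ℝ, EQ) (f := id) contMDiffAt_id (mem_chart_source EQ q)).1
    (𝔸.contMDiff_anchor_section s).contMDiffAt

variable [FiniteDimensional ℝ EQ] [T2Space Q] [ContMDiffVectorBundle ∞ F V 𝓘(ℝ, EQ)]

/-- The right-hand side is the commutator of `ρ(s)` and `ρ(t)` in the chart at `q`. Equality is
tested on functions with prescribed differential, and the factor `u` of `anchorDeriv_bracket_smul`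
is cancelled by choosing it non-zero at `q`. -/
theorem anchor_bracket (s t : Cₛ^∞⟮𝓘(ℝ, EQ); F, V⟯) (q : Q) :
    tangentCoord 𝓘(ℝ, EQ) q q (𝔸.anchor q (𝔸.bracket s t q)) =
      mvfderiv 𝓘(ℝ, EQ) (fun q' ↦ tangentCoord 𝓘(ℝ, EQ) q q' (𝔸.anchor q' (t q'))) q
        (𝔸.anchor q (s q)) -
      mvfderiv 𝓘(ℝ, EQ) (fun q' ↦ tangentCoord 𝓘(ℝ, EQ) q q' (𝔸.anchor q' (s q'))) q
        (𝔸.anchor q (t q)) := by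
  -- In rank zero there is no non-zero `u` to cancel, but then the anchor vanishes.
  rcases subsingleton_or_nontrivial F with hF | hF
  · simp only [anchor_eq_zero_of_subsingleton, map_zero, sub_zero]
  · have : Nontrivial (V q) := ((trivializationAt F V q).continuousLinearEquivAt ℝ q
      (FiberBundle.mem_baseSet_trivializationAt' q)).toEquiv.nontrivial
    obtain ⟨a, ha⟩ := exists_ne (0 : V q)
    rw [SeparatingDual.eq_iff_forall_dual_eq (R := ℝ)]
    intro l
    obtain ⟨f, hf⟩ := exists_contMDiffMap_dirDeriv_eq q l
    have hconst : constSection EQ F a q = a := by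
      have h := (exists_bump_trivializationAt EQ F V q).choose.eventuallyEq_one.self_of_nhds
      change (exists_bump_trivializationAt EQ F V q).choose q • FiberBundle.extend F a q = a
      rw [h]
      simp
    have h1 := 𝔸.anchorDeriv_bracket_smul s t (constSection EQ F a) f q
    rw [hconst, smul_eq_zero_iff_left ha, sub_eq_zero] at h1
    have h2 : ∀ s t : Cₛ^∞⟮𝓘(ℝ, EQ); F, V⟯, 𝔸.anchorDeriv s (𝔸.anchorDeriv t f) q =
        l (mvfderiv 𝓘(ℝ, EQ) (fun q' ↦ tangentCoord 𝓘(ℝ, EQ) q q' (𝔸.anchor q' (t q'))) q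
        (𝔸.anchor q (s q))) := by
      intro s t
      have h3 : (𝔸.anchorDeriv t f : Q → ℝ) =ᶠ[𝓝 q]
          l ∘ fun q' ↦ tangentCoord 𝓘(ℝ, EQ) q q' (𝔸.anchor q' (t q')) := by
        filter_upwards [hf] with q' hq'
        exact hq' _
      change mfderiv 𝓘(ℝ, EQ) 𝓘(ℝ, ℝ) (𝔸.anchorDeriv t f) q (𝔸.anchor q (s q)) = _
      rw [h3.mfderiv_eq]
      refine (mfderiv_comp_apply q l.mdifferentiableAt
        ((𝔸.contMDiffAt_tangentCoord_anchor_section t q).mdifferentiableAt (by simp)) _).trans ?_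
      rw [l.mfderiv_eq]
      rfl
    rw [map_sub, ← h2 s t, ← h2 t s, ← h1]
    exact (hf.self_of_nhds _).symm

end LieAlgebroid

end anchor

/-! ### The bracket of the prolongation in coordinates. -/

section bracket

variable {EQ : Type*} [NormedAddCommGroup EQ] [NormedSpace ℝ EQ]
  {Q : Type*} [TopologicalSpace Q] [ChartedSpace EQ Q] [IsManifold 𝓘(ℝ, EQ) ∞ Q]
  {G : Type*} [NormedAddCommGroup G] [NormedSpace ℝ G]
  {W : Q → Type*} [TopologicalSpace (TotalSpace G W)] [∀ q, AddCommGroup (W q)]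
  [∀ q, Module ℝ (W q)] [∀ q, TopologicalSpace (W q)] [FiberBundle G W] [VectorBundle ℝ G W]
  [ContMDiffVectorBundle ∞ G W 𝓘(ℝ, EQ)]
  {F : Type*} [NormedAddCommGroup F] [NormedSpace ℝ F]
  {V : Q → Type*} [TopologicalSpace (TotalSpace F V)] [∀ q, AddCommGroup (V q)]
  [∀ q, Module ℝ (V q)] [∀ q, TopologicalSpace (V q)] [FiberBundle F V] [VectorBundle ℝ F V]
  [ContMDiffVectorBundle ∞ F V 𝓘(ℝ, EQ)] [FiniteDimensional ℝ EQ] [T2Space Q]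

theorem constSection_eventuallyEq {q : Q} (a : V q) : ∀ᶠ q' in 𝓝 q,
    constSection EQ F a q' = (trivializationAt F V q).symmL ℝ q' (fibreCoord F q q a) := by
  filter_upwards [(exists_bump_trivializationAt EQ F V q).choose.eventuallyEq_one,
    (trivializationAt F V q).open_baseSet.mem_nhds (FiberBundle.mem_baseSet_trivializationAt' q)]
    with q' h1 h2
  change (exists_bump_trivializationAt EQ F V q).choose q' • FiberBundle.extend F a q' = _
  rw [h1, Pi.one_apply, one_smul, Trivialization.symmL_apply _ h2,
    fibreCoord_apply (FiberBundle.mem_baseSet_trivializationAt' q)]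
  simp [FiberBundle.extend]

theorem constSection_self {q : Q} (a : V q) : constSection EQ F a q = a :=
  (constSection_eventuallyEq a).self_of_nhds.trans
    (Trivialization.symmL_continuousLinearMapAt _ (FiberBundle.mem_baseSet_trivializationAt' q) a)

theorem Filter.EventuallyEq.mvfderiv_eq {EP : Type*} [NormedAddCommGroup EP] [NormedSpace ℝ EP]
    {HP : Type*} [TopologicalSpace HP] {J : ModelWithCorners ℝ EP HP}
    {P : Type*} [TopologicalSpace P] [ChartedSpace HP P] {E' : Type*} [NormedAddCommGroup E']
    [NormedSpace ℝ E'] {g g' : P → E'} {p : P} (h : g =ᶠ[𝓝 p] g') :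
    mvfderiv J g p = mvfderiv J g' p := by
  ext v
  exact congrArg (fun l : EP →L[ℝ] E' ↦ l v) (h.mfderiv_eq (I := J) (I' := 𝓘(ℝ, E')))

theorem mvfderiv_comp_mfderiv_apply {EP : Type*} [NormedAddCommGroup EP] [NormedSpace ℝ EP]
    {HP : Type*} [TopologicalSpace HP] {J : ModelWithCorners ℝ EP HP}
    {P : Type*} [TopologicalSpace P] [ChartedSpace HP P]
    {EP' : Type*} [NormedAddCommGroup EP'] [NormedSpace ℝ EP']
    {HP' : Type*} [TopologicalSpace HP'] {J' : ModelWithCorners ℝ EP' HP'}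
    {P' : Type*} [TopologicalSpace P'] [ChartedSpace HP' P'] {E' : Type*} [NormedAddCommGroup E']
    [NormedSpace ℝ E'] {f : P → P'} {g : P' → E'} {p : P}
    (hg : MDifferentiableAt J' 𝓘(ℝ, E') g (f p)) (hf : MDifferentiableAt J J' f p)
    (v : TangentSpace J p) :
    mvfderiv J (fun p' ↦ g (f p')) p v = mvfderiv J' g (f p) (mfderiv J J' f p v) :=
  mfderiv_comp_apply p hg hf v

theorem mvfderiv_clm_comp {EP : Type*} [NormedAddCommGroup EP] [NormedSpace ℝ EP]
    {HP : Type*} [TopologicalSpace HP] {J : ModelWithCorners ℝ EP HP}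
    {P : Type*} [TopologicalSpace P] [ChartedSpace HP P] {E₁ E₂ : Type*} [NormedAddCommGroup E₁]
    [NormedSpace ℝ E₁] [NormedAddCommGroup E₂] [NormedSpace ℝ E₂] (l : E₁ →L[ℝ] E₂) {g : P → E₁}
    {p : P} (hg : MDifferentiableAt J 𝓘(ℝ, E₁) g p) (v : TangentSpace J p) :
    mvfderiv J (fun p' ↦ l (g p')) p v = l (mvfderiv J g p v) := by
  refine (mfderiv_comp_apply p l.mdifferentiableAt hg v).trans ?_
  rw [l.mfderiv_eq]
  rfl

theorem flatDeriv_eq {EP : Type*} [NormedAddCommGroup EP] [NormedSpace ℝ EP]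
    {HP : Type*} [TopologicalSpace HP] {J : ModelWithCorners ℝ EP HP}
    {P : Type*} [TopologicalSpace P] [ChartedSpace HP P] {pr : P → Q} {p : P}
    (hpr : ContinuousAt pr p) (a : ∀ p, V (pr p)) (v : TangentSpace J p) :
    LieAlgebroid.flatDeriv (F := F) J pr a p v = (trivializationAt F V (pr p)).symmL ℝ (pr p)
      (mvfderiv J (fun p' ↦ fibreCoord F (pr p) (pr p') (a p')) p v) := by
  rw [Trivialization.symmL_apply _ (FiberBundle.mem_baseSet_trivializationAt' (pr p))]
  have h : (fun p' ↦ fibreCoord F (pr p) (pr p') (a p')) =ᶠ[𝓝 p]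
      fun p' ↦ (trivializationAt F V (pr p) ⟨pr p', a p'⟩).2 := by
    filter_upwards [hpr.preimage_mem_nhds ((trivializationAt F V (pr p)).open_baseSet.mem_nhds
      (FiberBundle.mem_baseSet_trivializationAt' (pr p)))] with x hx
    exact fibreCoord_apply hx _
  have h' : mvfderiv J (fun p' ↦ fibreCoord F (pr p) (pr p') (a p')) p v =
      mfderiv J 𝓘(ℝ, F) (fun p' ↦ fibreCoord F (pr p) (pr p') (a p')) p v := rfl
  rw [h', h.mfderiv_eq]
  rfl

namespace LieAlgebroid

variable (𝔸 : LieAlgebroid EQ F V)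

theorem mvfderiv_anchorCoord [FiniteDimensional ℝ F] {p : TotalSpace G W × ℝ} {z : TotalSpace G W × ℝ → F}
    (hz : ContMDiffAt (timesRealModel EQ G) 𝓘(ℝ, F) ∞ z p)
    (v : TangentSpace (timesRealModel EQ G) p) :
    mvfderiv (timesRealModel EQ G) (fun p' ↦ 𝔸.anchorCoord p.1.proj p'.1.proj (z p')) p v =
      mvfderiv 𝓘(ℝ, EQ) (fun q' ↦ 𝔸.anchorCoord p.1.proj q' (z p)) p.1.proj
        (mfderiv (timesRealModel EQ G) 𝓘(ℝ, EQ) (timesRealProj G W) p v) +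
      𝔸.anchorCoord p.1.proj p.1.proj (mvfderiv (timesRealModel EQ G) z p v) := by
  have hq := FiberBundle.mem_baseSet_trivializationAt' (F := F) (E := V) p.1.proj
  have hq' := mem_chart_source EQ p.1.proj
  have hpr : ContMDiffAt (timesRealModel EQ G) 𝓘(ℝ, EQ) ∞ (timesRealProj G W) p :=
    contMDiff_timesRealProj.contMDiffAt
  have hc : ∀ z₀ : F, ContMDiffAt 𝓘(ℝ, EQ) 𝓘(ℝ, EQ) ∞
      (fun q' ↦ 𝔸.anchorCoord p.1.proj q' z₀) p.1.proj := fun z₀ ↦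
    𝔸.contMDiffAt_anchorCoord (g := id) contMDiffAt_id contMDiffAt_const hq hq'
  have hc' : ∀ z₀ : F, MDifferentiableAt (timesRealModel EQ G) 𝓘(ℝ, EQ)
      (fun p' : TotalSpace G W × ℝ ↦ 𝔸.anchorCoord p.1.proj p'.1.proj z₀) p := fun z₀ ↦
    ((hc z₀).comp p hpr).mdifferentiableAt (by simp)
  have h1 : mvfderiv (timesRealModel EQ G)
      (fun p' : TotalSpace G W × ℝ ↦ 𝔸.anchorCoord p.1.proj p'.1.proj (z p)) p v =
      mvfderiv 𝓘(ℝ, EQ) (fun q' ↦ 𝔸.anchorCoord p.1.proj q' (z p)) p.1.proj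
        (mfderiv (timesRealModel EQ G) 𝓘(ℝ, EQ) (timesRealProj G W) p v) :=
    mvfderiv_comp_mfderiv_apply (f := timesRealProj G W) ((hc (z p)).mdifferentiableAt (by simp))
      (hpr.mdifferentiableAt (by simp)) v
  rw [← h1, SeparatingDual.eq_iff_forall_dual_eq (R := ℝ)]
  intro l
  -- After composition with a functional `l` the anchor is a family of linear forms on `F`, so the
  -- product rule for alternating maps applies with `k = 1`.
  have h2 := (mvfderiv_alternatingMap_apply (J := timesRealModel EQ G) (p := p) (k := 1) (K := F)
    (m := fun p' ↦ AlternatingMap.ofSubsingleton ℝ F ℝ 0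
      (l.toLinearMap ∘ₗ 𝔸.anchorCoord p.1.proj p'.1.proj)) (c := fun _ ↦ z)
    (fun z₀ ↦ l.mdifferentiableAt.comp p (hc' (z₀ 0)))
    (fun _ ↦ hz.mdifferentiableAt (by simp))).2 v
  simp only [Finset.univ_unique, Finset.sum_singleton, Fin.default_eq_zero] at h2
  have hfull := (𝔸.contMDiffAt_anchorCoord hpr hz hq hq').mdifferentiableAt (by simp)
  rw [map_add, ← mvfderiv_clm_comp l hfull, ← mvfderiv_clm_comp l (hc' (z p))]
  refine h2.trans (congrArg _ ?_)
  simp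

variable {σ τ : ∀ p : TotalSpace G W × ℝ,
    𝔸.Prolongation (timesRealModel EQ G) (timesRealProj G W) p} {U : Set (TotalSpace G W × ℝ)}
  {p : TotalSpace G W × ℝ}

theorem contMDiffAt_prolongCoord_section (hU : IsOpen U) (hp : p ∈ U)
    (hσ : 𝔸.SmoothSectionOn (timesRealModel EQ G) (timesRealProj G W) σ U) :
    ContMDiffAt (timesRealModel EQ G) 𝓘(ℝ, F × ((EQ × G) × ℝ)) ∞
      (fun p' ↦ 𝔸.prolongCoord p p' (σ p')) p :=
  𝔸.contMDiffAt_prolongCoord hU hp contMDiffAt_id hσ (mem_prolongDomain_self p)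

theorem flatDeriv_section (hU : IsOpen U) (hp : p ∈ U)
    (hσ : 𝔸.SmoothSectionOn (timesRealModel EQ G) (timesRealProj G W) σ U)
    (v : TangentSpace (timesRealModel EQ G) p) :
    flatDeriv (F := F) (timesRealModel EQ G) (timesRealProj G W) (fun p' ↦ (σ p').1.1) p v =
      (trivializationAt F V p.1.proj).symmL ℝ p.1.proj
        (mvfderiv (timesRealModel EQ G) (fun p' ↦ 𝔸.prolongCoord p p' (σ p')) p v).1 := by
  rw [flatDeriv_eq (contMDiff_timesRealProj (EQ := EQ)).continuous.continuousAt]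
  congr 1
  exact mvfderiv_clm_comp (ContinuousLinearMap.fst ℝ F ((EQ × G) × ℝ))
    ((𝔸.contMDiffAt_prolongCoord_section hU hp hσ).mdifferentiableAt (by simp)) v

theorem mlieBracket_section (hU : IsOpen U) (hp : p ∈ U)
    (hσ : 𝔸.SmoothSectionOn (timesRealModel EQ G) (timesRealProj G W) σ U)
    (hτ : 𝔸.SmoothSectionOn (timesRealModel EQ G) (timesRealProj G W) τ U) :
    VectorField.mlieBracket (timesRealModel EQ G) (fun p' ↦ (σ p').1.2) (fun p' ↦ (τ p').1.2) p =
      (mvfderiv (timesRealModel EQ G) (fun p' ↦ 𝔸.prolongCoord p p' (τ p')) p (σ p).1.2 -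
        mvfderiv (timesRealModel EQ G) (fun p' ↦ 𝔸.prolongCoord p p' (σ p')) p (τ p).1.2).2 := by
  have h1 := (𝔸.contMDiffAt_prolongCoord_section hU hp hσ).mdifferentiableAt (by simp)
  have h2 := (𝔸.contMDiffAt_prolongCoord_section hU hp hτ).mdifferentiableAt (by simp)
  have hl : ∀ x, MDifferentiableAt 𝓘(ℝ, F × ((EQ × G) × ℝ)) 𝓘(ℝ, (EQ × G) × ℝ)
      (ContinuousLinearMap.snd ℝ F ((EQ × G) × ℝ)) x := fun x ↦
    ContinuousLinearMap.mdifferentiableAt _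
  refine (mlieBracket_eq_tangentCoord (timesRealModel EQ G) (X := fun p' ↦ (σ p').1.2)
    (Y := fun p' ↦ (τ p').1.2) ((hl _).comp p h1) ((hl _).comp p h2)).trans ?_
  exact congrArg₂ (fun a b : (EQ × G) × ℝ ↦ a - b)
    (mvfderiv_clm_comp (ContinuousLinearMap.snd ℝ F ((EQ × G) × ℝ)) h2 _)
    (mvfderiv_clm_comp (ContinuousLinearMap.snd ℝ F ((EQ × G) × ℝ)) h1 _)

theorem prolongCoord_base {p₀ p' : TotalSpace G W × ℝ} (hp' : p' ∈ prolongDomain EQ G W F V p₀)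
    (w : 𝔸.Prolongation (timesRealModel EQ G) (timesRealProj G W) p') :
    (𝔸.prolongCoord p₀ p' w).2.1.1 =
      𝔸.anchorCoord p₀.1.proj p'.1.proj (𝔸.prolongCoord p₀ p' w).1 := by
  refine Eq.trans (tangentCoord_mfderiv_timesRealProj hp'.1 w.1.2).symm ?_
  refine Eq.trans ?_ (𝔸.anchorCoord_fibreCoord hp'.2 w.1.1).symm
  exact (congrArg (tangentCoord 𝓘(ℝ, EQ) p₀.1.proj p'.1.proj) w.2).symm

/-- Differentiate the coordinate form of `ρ(a) = Tπ(v)` by the product rule. The part where the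
anchor is differentiated involves the section frozen at its value at `p`, which near `pr p` is the
anchor of `constSection`. -/
theorem mvfderiv_prolongCoord_base [FiniteDimensional ℝ F] (hU : IsOpen U) (hp : p ∈ U)
    (hσ : 𝔸.SmoothSectionOn (timesRealModel EQ G) (timesRealProj G W) σ U)
    (w : 𝔸.Prolongation (timesRealModel EQ G) (timesRealProj G W) p) :
    (mvfderiv (timesRealModel EQ G) (fun p' ↦ 𝔸.prolongCoord p p' (σ p')) p w.1.2).2.1.1 =
      mvfderiv 𝓘(ℝ, EQ) (fun q' ↦ tangentCoord 𝓘(ℝ, EQ) p.1.proj q'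
        (𝔸.anchor q' (constSection EQ F (σ p).1.1 q'))) p.1.proj (𝔸.anchor p.1.proj w.1.1) +
      𝔸.anchorCoord p.1.proj p.1.proj
        (mvfderiv (timesRealModel EQ G) (fun p' ↦ 𝔸.prolongCoord p p' (σ p')) p w.1.2).1 := by
  have h1 := 𝔸.contMDiffAt_prolongCoord_section hU hp hσ
  have h1' := h1.mdifferentiableAt (by simp : (∞ : WithTop ℕ∞) ≠ 0)
  have h2 := 𝔸.mvfderiv_anchorCoord (z := fun p' ↦ (𝔸.prolongCoord p p' (σ p')).1)
    (contDiff_fst.contMDiff.contMDiffAt.comp p h1) w.1.2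
  have h3 : mvfderiv (timesRealModel EQ G) (fun p' ↦ (𝔸.prolongCoord p p' (σ p')).2.1.1) p w.1.2 =
      (mvfderiv (timesRealModel EQ G) (fun p' ↦ 𝔸.prolongCoord p p' (σ p')) p w.1.2).2.1.1 :=
    mvfderiv_clm_comp ((ContinuousLinearMap.fst ℝ EQ G) ∘L
      (ContinuousLinearMap.fst ℝ (EQ × G) ℝ) ∘L
      (ContinuousLinearMap.snd ℝ F ((EQ × G) × ℝ))) h1' w.1.2
  have h4 : mvfderiv (timesRealModel EQ G) (fun p' ↦ (𝔸.prolongCoord p p' (σ p')).1) p w.1.2 =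
      (mvfderiv (timesRealModel EQ G) (fun p' ↦ 𝔸.prolongCoord p p' (σ p')) p w.1.2).1 :=
    mvfderiv_clm_comp (ContinuousLinearMap.fst ℝ F ((EQ × G) × ℝ)) h1' w.1.2
  have h5 : (fun p' ↦ (𝔸.prolongCoord p p' (σ p')).2.1.1) =ᶠ[𝓝 p]
      fun p' ↦ 𝔸.anchorCoord p.1.proj p'.1.proj (𝔸.prolongCoord p p' (σ p')).1 := by
    filter_upwards [(isOpen_prolongDomain (EQ := EQ) (F := F) (V := V) p).mem_nhds
      (mem_prolongDomain_self p)] with p' hp'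
    exact 𝔸.prolongCoord_base hp' (σ p')
  have h6 : (fun q' ↦ tangentCoord 𝓘(ℝ, EQ) p.1.proj q'
        (𝔸.anchor q' (constSection EQ F (σ p).1.1 q'))) =ᶠ[𝓝 p.1.proj]
      fun q' ↦ 𝔸.anchorCoord p.1.proj q' (𝔸.prolongCoord p p (σ p)).1 := by
    filter_upwards [constSection_eventuallyEq (EQ := EQ) (F := F) (σ p).1.1] with q' hq'
    rw [hq']
    rfl
  have h7 : 𝔸.anchor p.1.proj w.1.1 =
      mfderiv (timesRealModel EQ G) 𝓘(ℝ, EQ) (timesRealProj G W) p w.1.2 := w.2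
  rw [← h3, ← h4, h5.mvfderiv_eq, h6.mvfderiv_eq, h2, h7]

/-- The base component of `[X, Y]` splits into the anchor of the flat derivatives and the commutator
of the anchors of two constant sections. By `anchor_bracket` the latter is the anchor of their
bracket. Hence `prolongationBracket` takes its true value on smooth sections. -/
theorem prolongationBracketAux_mem [FiniteDimensional ℝ F] (hU : IsOpen U) (hp : p ∈ U)
    (hσ : 𝔸.SmoothSectionOn (timesRealModel EQ G) (timesRealProj G W) σ U)
    (hτ : 𝔸.SmoothSectionOn (timesRealModel EQ G) (timesRealProj G W) τ U) :
    𝔸.prolongationBracketAux (timesRealModel EQ G) (timesRealProj G W) σ τ p ∈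
      𝔸.Prolongation (timesRealModel EQ G) (timesRealProj G W) p := by
  obtain ⟨e, he⟩ := isInvertible_tangentCoord 𝓘(ℝ, EQ) (mem_chart_source EQ p.1.proj)
  have hinj : Function.Injective (tangentCoord 𝓘(ℝ, EQ) p.1.proj p.1.proj) := by
    rw [← he]; exact e.injective
  refine hinj (Eq.trans ?_ (tangentCoord_mfderiv_timesRealProj (mem_chart_source _ p) _).symm)
  have h1 : tangentCoord (timesRealModel EQ G) p p
      (VectorField.mlieBracket (timesRealModel EQ G) (fun p' ↦ (σ p').1.2) (fun p' ↦ (τ p').1.2) p) =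
      (mvfderiv (timesRealModel EQ G) (fun p' ↦ 𝔸.prolongCoord p p' (τ p')) p (σ p).1.2 -
        mvfderiv (timesRealModel EQ G) (fun p' ↦ 𝔸.prolongCoord p p' (σ p')) p (τ p).1.2).2 :=
    (tangentCoord_self _ _ _).trans (𝔸.mlieBracket_section hU hp hσ hτ)
  refine Eq.trans ?_ (congrArg (fun u : (EQ × G) × ℝ ↦ u.1.1) h1).symm
  simp only [Prod.snd_sub, Prod.fst_sub]
  rw [𝔸.mvfderiv_prolongCoord_base hU hp hτ (σ p), 𝔸.mvfderiv_prolongCoord_base hU hp hσ (τ p)]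
  have h2 := 𝔸.anchor_bracket (constSection EQ F (σ p).1.1) (constSection EQ F (τ p).1.1) p.1.proj
  rw [constSection_self, constSection_self] at h2
  change tangentCoord 𝓘(ℝ, EQ) p.1.proj p.1.proj (𝔸.anchor p.1.proj (_ + _ - _)) = _
  rw [𝔸.flatDeriv_section hU hp hτ, 𝔸.flatDeriv_section hU hp hσ, map_sub, map_add, map_sub,
    map_add]
  refine (congrArg (fun u : EQ ↦ u + _ - _) h2).trans ?_
  change _ - _ + 𝔸.anchorCoord _ _ _ - 𝔸.anchorCoord _ _ _ = _
  abel

end LieAlgebroid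

end bracket

/-! ### Tensoriality of the Koszul formula. -/

section koszul

variable {EQ : Type*} [NormedAddCommGroup EQ] [NormedSpace ℝ EQ]
  {Q : Type*} [TopologicalSpace Q] [ChartedSpace EQ Q] [IsManifold 𝓘(ℝ, EQ) ∞ Q]
  {G : Type*} [NormedAddCommGroup G] [NormedSpace ℝ G]
  {W : Q → Type*} [TopologicalSpace (TotalSpace G W)] [∀ q, AddCommGroup (W q)]
  [∀ q, Module ℝ (W q)] [∀ q, TopologicalSpace (W q)] [FiberBundle G W] [VectorBundle ℝ G W]
  [ContMDiffVectorBundle ∞ G W 𝓘(ℝ, EQ)]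
  {F : Type*} [NormedAddCommGroup F] [NormedSpace ℝ F]
  {V : Q → Type*} [TopologicalSpace (TotalSpace F V)] [∀ q, AddCommGroup (V q)]
  [∀ q, Module ℝ (V q)] [∀ q, TopologicalSpace (V q)] [FiberBundle F V] [VectorBundle ℝ F V]
  [ContMDiffVectorBundle ∞ F V 𝓘(ℝ, EQ)] [FiniteDimensional ℝ EQ] [T2Space Q]
  [FiniteDimensional ℝ F]

namespace LieAlgebroid

variable (𝔸 : LieAlgebroid EQ F V)

section

variable {p : TotalSpace G W × ℝ}
  {σ τ : ∀ p : TotalSpace G W × ℝ,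
    𝔸.Prolongation (timesRealModel EQ G) (timesRealProj G W) p} {U : Set (TotalSpace G W × ℝ)}

/-- The structure function of the prolongation at `p` in the frame given by `prolongFrame p`. -/
noncomputable def prolongStructure
    (w w' : 𝔸.Prolongation (timesRealModel EQ G) (timesRealProj G W) p) :
    𝔸.Prolongation (timesRealModel EQ G) (timesRealProj G W) p :=
  𝔸.prolongFrame p p (fibreCoord F p.1.proj p.1.proj
    (𝔸.bracket (constSection EQ F w.1.1) (constSection EQ F w'.1.1) p.1.proj), 0)

theorem prolongCoord_prolongationBracket (hU : IsOpen U) (hp : p ∈ U)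
    (hσ : 𝔸.SmoothSectionOn (timesRealModel EQ G) (timesRealProj G W) σ U)
    (hτ : 𝔸.SmoothSectionOn (timesRealModel EQ G) (timesRealProj G W) τ U) :
    𝔸.prolongCoord p p
        (𝔸.prolongationBracket (timesRealModel EQ G) (timesRealProj G W) σ τ p) =
      mvfderiv (timesRealModel EQ G) (fun p' ↦ 𝔸.prolongCoord p p' (τ p')) p (σ p).1.2 -
      mvfderiv (timesRealModel EQ G) (fun p' ↦ 𝔸.prolongCoord p p' (σ p')) p (τ p).1.2 +
      (fibreCoord F p.1.proj p.1.proj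
        (𝔸.bracket (constSection EQ F (σ p).1.1) (constSection EQ F (τ p).1.1) p.1.proj), 0) := by
  rw [prolongationBracket, dif_pos (𝔸.prolongationBracketAux_mem hU hp hσ hτ)]
  have hq := FiberBundle.mem_baseSet_trivializationAt' (F := F) (E := V) p.1.proj
  refine Prod.ext ?_ ?_
  · change fibreCoord F p.1.proj p.1.proj ((_ + _ - _ : V p.1.proj)) = _
    rw [𝔸.flatDeriv_section hU hp hτ, 𝔸.flatDeriv_section hU hp hσ, map_sub, map_add,
      fibreCoord_symmL hq, fibreCoord_symmL hq]
    simp only [Prod.fst_add, Prod.fst_sub]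
    abel
  · rw [Prod.snd_add, add_zero]
    exact (tangentCoord_self _ _ _).trans (𝔸.mlieBracket_section hU hp hσ hτ)

/-- Derivatives of the sections enter only through the flat commutator; the remaining term depends
on their values at `p` alone. -/
theorem prolongationBracket_eq (hU : IsOpen U) (hp : p ∈ U)
    (hσ : 𝔸.SmoothSectionOn (timesRealModel EQ G) (timesRealProj G W) σ U)
    (hτ : 𝔸.SmoothSectionOn (timesRealModel EQ G) (timesRealProj G W) τ U) :
    𝔸.prolongationBracket (timesRealModel EQ G) (timesRealProj G W) σ τ p =
      𝔸.prolongFrame p p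
        (mvfderiv (timesRealModel EQ G) (fun p' ↦ 𝔸.prolongCoord p p' (τ p')) p (σ p).1.2 -
        mvfderiv (timesRealModel EQ G) (fun p' ↦ 𝔸.prolongCoord p p' (σ p')) p (τ p).1.2) +
      𝔸.prolongStructure (σ p) (τ p) := by
  rw [prolongStructure, ← map_add, ← 𝔸.prolongCoord_prolongationBracket hU hp hσ hτ,
    𝔸.prolongFrame_prolongCoord (mem_prolongDomain_self p)]

/-- The bracket terms of the exterior derivative for sections which are constant in the frame
`prolongFrame p`. -/
noncomputable def structureTerms : {k : ℕ} →
    𝔸.ProlongationForm (timesRealModel EQ G) (timesRealProj G W) k →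
    (Fin (k + 1) → 𝔸.Prolongation (timesRealModel EQ G) (timesRealProj G W) p) → ℝ
  | 0, _, _ => 0
  | k + 1, μ, w => ∑ i : Fin (k + 1), ∑ j ∈ Finset.Ici i,
      (-1 : ℝ) ^ ((i : ℕ) + ((j : ℕ) + 1)) *
        μ p (Fin.cons (𝔸.prolongStructure (w i.castSucc) (w j.succ))
          (j.removeNth (i.castSucc.removeNth w)))

end

variable [FiniteDimensional ℝ G] {p : TotalSpace G W × ℝ} {U : Set (TotalSpace G W × ℝ)} {k : ℕ}
  {μ : 𝔸.ProlongationForm (timesRealModel EQ G) (timesRealProj G W) k}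

/-- The right-hand side involves the sections only through their values at `p`. Differentiability of
`μ` is required only for its coefficients in the frame at `p`, a condition that pulled-back forms
are easily seen to satisfy. -/
theorem koszul_eq_structureTerms (hμ : ∀ z : Fin k → F × ((EQ × G) × ℝ),
      MDifferentiableAt (timesRealModel EQ G) 𝓘(ℝ, ℝ)
        (fun p' ↦ μ p' (fun i ↦ 𝔸.prolongFrame p p' (z i))) p)
    {σ : Fin (k + 1) → ∀ p : TotalSpace G W × ℝ,
      𝔸.Prolongation (timesRealModel EQ G) (timesRealProj G W) p}
    (hU : IsOpen U) (hp : p ∈ U)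
    (hσ : ∀ i, 𝔸.SmoothSectionOn (timesRealModel EQ G) (timesRealProj G W) (σ i) U) :
    𝔸.koszul (timesRealModel EQ G) (timesRealProj G W) μ σ p =
      ∑ i : Fin (k + 1), (-1 : ℝ) ^ (i : ℕ) * mvfderiv (timesRealModel EQ G)
        (fun p' ↦ μ p' (fun j ↦ 𝔸.prolongFrame p p' (𝔸.prolongCoord p p (i.removeNth (σ · p) j))))
          p (σ i p).1.2 + 𝔸.structureTerms μ (σ · p) := by
  set c : Fin (k + 1) → TotalSpace G W × ℝ → F × ((EQ × G) × ℝ) :=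
    fun i p' ↦ 𝔸.prolongCoord p p' (σ i p') with hc_def
  set m : ∀ p' : TotalSpace G W × ℝ, (F × ((EQ × G) × ℝ)) [⋀^Fin k]→ₗ[ℝ] ℝ :=
    fun p' ↦ (μ p').compLinearMap (𝔸.prolongFrame p p') with hm_def
  have hc : ∀ i, MDifferentiableAt (timesRealModel EQ G) 𝓘(ℝ, F × ((EQ × G) × ℝ)) (c i) p :=
    fun i ↦ (𝔸.contMDiffAt_prolongCoord_section hU hp (hσ i)).mdifferentiableAt (by simp)
  -- The product rule separates the derivative of the coefficients of `μ`, with frozen arguments,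
  -- from the derivatives of the coordinates of the sections.
  have hder : ∀ i : Fin (k + 1), dirDeriv (timesRealModel EQ G)
      (fun p' ↦ μ p' (i.removeNth (fun l ↦ σ l p'))) p (σ i p).1.2 =
      mvfderiv (timesRealModel EQ G) (fun p' ↦ m p' (i.removeNth (c · p))) p (σ i p).1.2 +
      ∑ j, m p (Function.update (i.removeNth (c · p)) j
        (mvfderiv (timesRealModel EQ G) (c (i.succAbove j)) p (σ i p).1.2)) := by
    intro i
    have h1 : (fun p' ↦ μ p' (i.removeNth (fun l ↦ σ l p'))) =ᶠ[𝓝 p]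
        fun p' ↦ m p' (fun j ↦ c (i.succAbove j) p') := by
      filter_upwards [(isOpen_prolongDomain (EQ := EQ) (F := F) (V := V) p).mem_nhds
        (mem_prolongDomain_self p)] with p' hp'
      simp only [hm_def, hc_def, AlternatingMap.compLinearMap_apply]
      congr 1
      funext j
      exact (𝔸.prolongFrame_prolongCoord hp' _).symm
    have h2 := (mvfderiv_alternatingMap_apply (m := m) (c := fun j ↦ c (i.succAbove j)) hμ
      (fun j ↦ hc _)).2 (σ i p).1.2
    refine Eq.trans ?_ h2
    exact congrArg (fun l : TangentSpace (timesRealModel EQ G) p →L[ℝ] ℝ ↦ l (σ i p).1.2)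
      h1.mvfderiv_eq
  have hrec : ∀ i, 𝔸.prolongFrame p p (c i p) = σ i p := fun i ↦
    𝔸.prolongFrame_prolongCoord (mem_prolongDomain_self p) _
  rw [koszul]
  simp only [hder, mul_add, Finset.sum_add_distrib]
  rw [add_assoc]
  refine congrArg₂ (· + ·) rfl ?_
  cases k with
  | zero => simp [bracketTerms, structureTerms]
  | succ n =>
    rw [bracketTerms, structureTerms]
    have h3 : ∀ (i : Fin (n + 1)) (j : Fin (n + 1)),
        μ p (Fin.cons (𝔸.prolongationBracket (timesRealModel EQ G) (timesRealProj G W)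
          (σ i.castSucc) (σ j.succ) p) (j.removeNth (i.castSucc.removeNth (fun l ↦ σ l p)))) =
        m p (Fin.cons (mvfderiv (timesRealModel EQ G) (c j.succ) p (σ i.castSucc p).1.2 -
          mvfderiv (timesRealModel EQ G) (c i.castSucc) p (σ j.succ p).1.2)
          (j.removeNth (i.castSucc.removeNth (c · p)))) +
        μ p (Fin.cons (𝔸.prolongStructure (σ i.castSucc p) (σ j.succ p))
          (j.removeNth (i.castSucc.removeNth (σ · p)))) := by
      intro i j
      rw [𝔸.prolongationBracket_eq hU hp (hσ _) (hσ _)]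
      have hadd : ∀ x y t, μ p (Fin.cons (x + y) t) = μ p (Fin.cons x t) + μ p (Fin.cons y t) := by
        intro x y t
        have h := (μ p).map_update_add (Fin.cons x t) 0 x y
        simpa [Fin.update_cons_zero] using h
      rw [hadd]
      congr 1
      simp only [hm_def, AlternatingMap.compLinearMap_apply]
      congr 1
      funext l
      refine Fin.cases ?_ (fun l ↦ ?_) l
      · rfl
      · simp only [Fin.cons_succ]
        exact (hrec _).symm
    simp only [h3, mul_add, Finset.sum_add_distrib]
    rw [← add_assoc]
    -- The derivatives of the coordinates cancel against the flat commutators.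
    have h4 := (m p).sum_update_removeNth_add_sum_cons_eq_zero (c · p)
      (fun i j ↦ mvfderiv (timesRealModel EQ G) (c j) p (σ i p).1.2)
    rw [h4, zero_add]

/-- This makes `extDeriv` independent of the extensions picked by `sectionThrough`. -/
theorem koszul_congr (hμ : ∀ z : Fin k → F × ((EQ × G) × ℝ),
      MDifferentiableAt (timesRealModel EQ G) 𝓘(ℝ, ℝ)
        (fun p' ↦ μ p' (fun i ↦ 𝔸.prolongFrame p p' (z i))) p)
    {σ τ : Fin (k + 1) → ∀ p : TotalSpace G W × ℝ,
      𝔸.Prolongation (timesRealModel EQ G) (timesRealProj G W) p}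
    (hσ : ∀ i, ∃ U ∈ 𝓝 p, IsOpen U ∧
      𝔸.SmoothSectionOn (timesRealModel EQ G) (timesRealProj G W) (σ i) U)
    (hτ : ∀ i, ∃ U ∈ 𝓝 p, IsOpen U ∧
      𝔸.SmoothSectionOn (timesRealModel EQ G) (timesRealProj G W) (τ i) U)
    (h : ∀ i, σ i p = τ i p) :
    𝔸.koszul (timesRealModel EQ G) (timesRealProj G W) μ σ p =
      𝔸.koszul (timesRealModel EQ G) (timesRealProj G W) μ τ p := by
  have key : ∀ {σ : Fin (k + 1) → ∀ p : TotalSpace G W × ℝ,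
      𝔸.Prolongation (timesRealModel EQ G) (timesRealProj G W) p},
      (∀ i, ∃ U ∈ 𝓝 p, IsOpen U ∧
        𝔸.SmoothSectionOn (timesRealModel EQ G) (timesRealProj G W) (σ i) U) →
      ∃ U, IsOpen U ∧ p ∈ U ∧
        ∀ i, 𝔸.SmoothSectionOn (timesRealModel EQ G) (timesRealProj G W) (σ i) U := by
    intro σ hσ
    choose U hU hUo hUs using hσ
    exact ⟨⋂ i, U i, isOpen_iInter_of_finite hUo, mem_iInter.2 fun i ↦ mem_of_mem_nhds (hU i),
      fun i ↦ ⟨(hUs i).1.mono (iInter_subset _ i), (hUs i).2.mono (iInter_subset _ i)⟩⟩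
  obtain ⟨U, hU, hpU, hUs⟩ := key hσ
  obtain ⟨U', hU', hpU', hUs'⟩ := key hτ
  rw [𝔸.koszul_eq_structureTerms hμ hU hpU hUs, 𝔸.koszul_eq_structureTerms hμ hU' hpU' hUs']
  simp only [h]

end LieAlgebroid

end koszul

/-! ### Regularity and the derivative of the Legendre map. -/

section legendre

variable {EQ : Type*} [NormedAddCommGroup EQ] [NormedSpace ℝ EQ]
  {Q : Type*} [TopologicalSpace Q] [ChartedSpace EQ Q] [IsManifold 𝓘(ℝ, EQ) ∞ Q]
  {F : Type*} [NormedAddCommGroup F] [NormedSpace ℝ F]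
  {V : Q → Type*} [TopologicalSpace (TotalSpace F V)] [∀ q, AddCommGroup (V q)]
  [∀ q, Module ℝ (V q)] [∀ q, TopologicalSpace (V q)] [FiberBundle F V] [VectorBundle ℝ F V]
  [ContMDiffVectorBundle ∞ F V 𝓘(ℝ, EQ)]

theorem extChartAt_comp_fibreMap (q : Q) (s : ℝ) (y₀ : F) :
    extChartAt (timesRealModel EQ F) (fibreMap F V q s y₀) ∘ fibreMap F V q s =
      fun y ↦ ((extChartAt 𝓘(ℝ, EQ) q q, y), s) := by
  funext y
  have hq := FiberBundle.mem_baseSet_trivializationAt' (F := F) (E := V) q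
  simp only [Function.comp_apply, extChartAt_prod, FiberBundle.extChartAt, fibreMap]
  simp [hq]
  rfl

theorem fibreMapDeriv_eq (p : TotalSpace F V × ℝ) (a : V p.1.proj) :
    (fibreMapDeriv EQ p a : (EQ × F) × ℝ) = ((0, fibreCoord F p.1.proj p.1.proj a), 0) := by
  have hq := FiberBundle.mem_baseSet_trivializationAt' (F := F) (E := V) p.1.proj
  set φ := (trivializationAt F V p.1.proj).continuousLinearEquivAt ℝ p.1.proj hq
  have h1 : (φ a : F) = fibreCoord F p.1.proj p.1.proj a :=
    (fibreCoord_apply hq a).symm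
  have h2 : (mfderiv 𝓘(ℝ, F) (timesRealModel EQ F) (fibreMap F V p.1.proj p.2) (φ p.1.snd) :
      F →L[ℝ] (EQ × F) × ℝ) = fderiv ℝ (fun y : F ↦
        ((extChartAt 𝓘(ℝ, EQ) p.1.proj p.1.proj, y), p.2)) (φ p.1.snd) := by
    have h := ((contMDiff_fibreMap (EQ := EQ) (V := V) p.1.proj p.2).mdifferentiableAt
      (x := φ p.1.snd) (by simp)).mfderiv
    refine h.trans ?_
    simp only [mfld_simps, writtenInExtChartAt, fderivWithin_univ]
    exact congrArg (fun g : F → (EQ × F) × ℝ ↦ fderiv ℝ g (φ p.1.snd))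
      (extChartAt_comp_fibreMap p.1.proj p.2 (φ p.1.snd))
  have h3 : HasFDerivAt (fun y : F ↦ ((extChartAt 𝓘(ℝ, EQ) p.1.proj p.1.proj, y), p.2))
      (((0 : F →L[ℝ] EQ).prod (ContinuousLinearMap.id ℝ F)).prod (0 : F →L[ℝ] ℝ)) (φ p.1.snd) :=
    ((hasFDerivAt_const _ _).prodMk (hasFDerivAt_id _)).prodMk (hasFDerivAt_const _ _)
  rw [h3.fderiv] at h2
  refine (congrArg (fun l : F →L[ℝ] (EQ × F) × ℝ ↦ l (φ a)) h2).trans ?_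
  rw [← h1]
  rfl

/-- In the bundle chart at `p`, the two hypotheses kill the `EQ`- and `ℝ`-components of `v`, leaving
a vector along the fibre. -/
theorem exists_fibreMapDeriv_eq {p : TotalSpace F V × ℝ} {v : TangentSpace (timesRealModel EQ F) p}
    (h1 : mfderiv (timesRealModel EQ F) 𝓘(ℝ, EQ) (timesRealProj F V) p v = 0)
    (h2 : dirDeriv (timesRealModel EQ F) (Prod.snd : TotalSpace F V × ℝ → ℝ) p v = 0) :
    ∃ a : V p.1.proj, fibreMapDeriv EQ p a = v := by
  have hq := FiberBundle.mem_baseSet_trivializationAt' (F := F) (E := V) p.1.proj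
  have h3 : (v : (EQ × F) × ℝ).1.1 = 0 := by
    have h4 := tangentCoord_mfderiv_timesRealProj (mem_chart_source _ p) v
    rw [h1, map_zero] at h4
    exact (h4.trans (congrArg (fun u : (EQ × F) × ℝ ↦ u.1.1) (tangentCoord_self _ p v))).symm
  have h5 : (v : (EQ × F) × ℝ).2 = 0 := by
    have h6 : mfderiv (timesRealModel EQ F) 𝓘(ℝ, ℝ) (Prod.snd : TotalSpace F V × ℝ → ℝ) p v =
      (v : (EQ × F) × ℝ).2 := congrArg (fun l : (EQ × F) × ℝ →L[ℝ] ℝ ↦ l v) mfderiv_snd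
    exact h6.symm.trans h2
  refine ⟨(trivializationAt F V p.1.proj).symmL ℝ p.1.proj (v : (EQ × F) × ℝ).1.2, ?_⟩
  refine (fibreMapDeriv_eq p _).trans ?_
  rw [fibreCoord_symmL hq]
  exact Prod.ext (Prod.ext h3.symm rfl) h5.symm

variable [∀ q, IsTopologicalAddGroup (V q)] [∀ q, ContinuousSMul ℝ (V q)]

theorem ContMDiffOn.dual_apply {EN : Type*} [NormedAddCommGroup EN] [NormedSpace ℝ EN]
    {HN : Type*} [TopologicalSpace HN] {JN : ModelWithCorners ℝ EN HN}
    {N : Type*} [TopologicalSpace N] [ChartedSpace HN N] {g : N → Q}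
    {ν : ∀ x, V (g x) →L[ℝ] ℝ} {a : ∀ x, V (g x)} {U : Set N}
    (hν : ContMDiffOn JN (𝓘(ℝ, EQ).prod 𝓘(ℝ, F →L[ℝ] ℝ)) ∞
      (fun x ↦ (⟨g x, ν x⟩ : TotalSpace (F →L[ℝ] ℝ) (fun q ↦ V q →L[ℝ] ℝ))) U)
    (ha : ContMDiffOn JN (𝓘(ℝ, EQ).prod 𝓘(ℝ, F)) ∞ (fun x ↦ (⟨g x, a x⟩ : TotalSpace F V)) U) :
    ContMDiffOn JN 𝓘(ℝ, ℝ) ∞ (fun x ↦ ν x (a x)) U := by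
  have h := ContMDiffOn.clm_bundle_apply (E₂ := fun _ : Q ↦ ℝ) (F₂ := ℝ) hν ha
  intro x hx
  exact (contMDiffWithinAt_totalSpace.1 (h x hx)).2

variable (L : C^∞⟮timesRealModel EQ F, TotalSpace F V × ℝ; ℝ⟯)

variable [FiniteDimensional ℝ EQ] [T2Space Q]

theorem contMDiff_dual_apply_section (e : Cₛ^∞⟮𝓘(ℝ, EQ); F, V⟯) :
    ContMDiff (timesRealModel EQ (F →L[ℝ] ℝ)) 𝓘(ℝ, ℝ) ∞
      (fun p : TotalSpace (F →L[ℝ] ℝ) (fun q ↦ V q →L[ℝ] ℝ) × ℝ ↦ p.1.snd (e p.1.proj)) := by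
  rw [← contMDiffOn_univ]
  exact ContMDiffOn.dual_apply (EQ := EQ) (F := F) (V := V)
    (g := fun p : TotalSpace (F →L[ℝ] ℝ) (fun q ↦ V q →L[ℝ] ℝ) × ℝ ↦ p.1.proj)
    (ν := fun p ↦ p.1.snd) (a := fun p ↦ e p.1.proj) contMDiff_fst.contMDiffOn
    (e.contMDiff.comp (contMDiff_timesRealProj (EQ := EQ))).contMDiffOn

theorem mfderiv_comp_legendre_eq_zero {E' : Type*} [NormedAddCommGroup E'] [NormedSpace ℝ E']
    {H' : Type*} [TopologicalSpace H'] {J' : ModelWithCorners ℝ E' H'}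
    {M : Type*} [TopologicalSpace M] [ChartedSpace H' M]
    {g : TotalSpace (F →L[ℝ] ℝ) (fun q ↦ V q →L[ℝ] ℝ) × ℝ → M} {p : TotalSpace F V × ℝ}
    (hg : MDifferentiableAt (timesRealModel EQ (F →L[ℝ] ℝ)) J' g (legendre L p))
    {v : TangentSpace (timesRealModel EQ F) p}
    (hv : mfderiv (timesRealModel EQ F) (timesRealModel EQ (F →L[ℝ] ℝ)) (legendre L) p v = 0) :
    mfderiv (timesRealModel EQ F) J' (g ∘ legendre L) p v = 0 := by
  have h := mfderiv_comp_apply p hg ((contMDiff_legendre L).mdifferentiableAt (by simp)) v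
  exact h.trans ((congrArg (mfderiv (timesRealModel EQ (F →L[ℝ] ℝ)) J' g (legendre L p)) hv).trans
    (ContinuousLinearMap.map_zero _))

/-- The function `p ↦ (fibre derivative of L at p)(e)` for a section `e`. -/
noncomputable def fibreDerivSection (e : Cₛ^∞⟮𝓘(ℝ, EQ); F, V⟯) :
    C^∞⟮timesRealModel EQ F, TotalSpace F V × ℝ; ℝ⟯ :=
  ⟨fun p ↦ fibreDeriv L p (e p.1.proj),
    (contMDiff_dual_apply_section e).comp (contMDiff_legendre L)⟩

/-- Pairing with a section is a smooth function on `V* × ℝ`; its composite with `Leg` is the fibre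
derivative of `L` in that direction. Its derivative along the vertical vector of `a` vanishes, so
the Hessian annihilates `a`. -/
theorem eq_zero_of_mfderiv_legendre_fibreMapDeriv [FiniteDimensional ℝ F]
    (hL : IsRegularLagrangian L) {p : TotalSpace F V × ℝ} {a : V p.1.proj}
    (ha : mfderiv (timesRealModel EQ F) (timesRealModel EQ (F →L[ℝ] ℝ)) (legendre L) p
      (fibreMapDeriv EQ p a) = 0) : a = 0 := by
  have hq := FiberBundle.mem_baseSet_trivializationAt' (F := F) (E := V) p.1.proj
  have hfin : FiniteDimensional ℝ (V p.1.proj) :=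
    ((trivializationAt F V p.1.proj).continuousLinearEquivAt ℝ p.1.proj
      hq).toLinearEquiv.symm.finiteDimensional
  set e := Module.finBasis ℝ (V p.1.proj)
  have h3 : ∀ β, ∃ l : V p.1.proj →ₗ[ℝ] ℝ, (∀ b, deriv (fun t : ℝ ↦
      fibreDeriv L (⟨p.1.proj, p.1.snd + t • b⟩, p.2) (e β)) 0 = l b) ∧ l a = 0 := by
    intro β
    refine ⟨((mfderiv (timesRealModel EQ F) 𝓘(ℝ, ℝ)
      (fibreDerivSection L (constSection EQ F (e β))) p).comp (fibreMapDeriv EQ p)).toLinearMap,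
      fun b ↦ ?_, ?_⟩
    · have h := deriv_fibre_curve (fibreDerivSection L (constSection EQ F (e β))) p b
      refine Eq.trans ?_ h
      congr 1
      funext t
      change _ = fibreDeriv L (⟨p.1.proj, p.1.snd + t • b⟩, p.2)
        (constSection EQ F (e β) p.1.proj)
      rw [constSection_self]
    · exact mfderiv_comp_legendre_eq_zero L (J' := 𝓘(ℝ, ℝ))
        ((contMDiff_dual_apply_section (constSection EQ F (e β))).mdifferentiableAt (by simp)) ha
  choose l hl hla using h3
  -- The `(α, β)` entry of the Hessian is `l β (e α)`, so the row vector of coordinates of `a` is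
  -- sent to `β ↦ l β a = 0`.
  have h4 := Matrix.eq_zero_of_vecMul_eq_zero (hL p e) (v := e.repr a) (by
    funext β
    rw [Matrix.vecMul, dotProduct]
    simp only [Matrix.of_apply, hl, Pi.zero_apply]
    rw [← hla β]
    conv_rhs => rw [← e.sum_repr a]
    rw [map_sum]
    exact Finset.sum_congr rfl fun α _ ↦ (map_smul (l β) _ _).symm)
  exact e.repr.map_eq_zero_iff.1 (Finsupp.ext fun α ↦ congrFun h4 α)

/-- `Leg` commutes with the projections to `Q` and to `ℝ`, so the kernel of its derivative is
vertical, and there the Hessian decides. -/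
theorem mfderiv_legendre_injective [FiniteDimensional ℝ F] (hL : IsRegularLagrangian L)
    (p : TotalSpace F V × ℝ) :
    Function.Injective (mfderiv (timesRealModel EQ F) (timesRealModel EQ (F →L[ℝ] ℝ))
      (legendre L) p) := by
  have key : ∀ v : TangentSpace (timesRealModel EQ F) p, mfderiv (timesRealModel EQ F)
      (timesRealModel EQ (F →L[ℝ] ℝ)) (legendre L) p v = 0 → v = 0 := by
    intro v hv
    obtain ⟨a, rfl⟩ := exists_fibreMapDeriv_eq
      (mfderiv_comp_legendre_eq_zero L (J' := 𝓘(ℝ, EQ))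
        ((contMDiff_timesRealProj (EQ := EQ)).mdifferentiableAt (by simp)) hv)
      (mfderiv_comp_legendre_eq_zero L (J' := 𝓘(ℝ, ℝ)) (g := Prod.snd) mdifferentiableAt_snd hv)
    rw [eq_zero_of_mfderiv_legendre_fibreMapDeriv L hL hv, map_zero]
  intro v v' h
  refine sub_eq_zero.1 (key (v - v') ?_)
  exact (ContinuousLinearMap.map_sub _ v v').trans (sub_eq_zero.2 h)

theorem isInvertible_mfderiv_legendre [FiniteDimensional ℝ F] (hL : IsRegularLagrangian L)
    (p : TotalSpace F V × ℝ) :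
    (mfderiv (timesRealModel EQ F) (timesRealModel EQ (F →L[ℝ] ℝ))
      (legendre L) p).IsInvertible := by
  have key : ∀ l : (EQ × F) × ℝ →L[ℝ] (EQ × (F →L[ℝ] ℝ)) × ℝ, Function.Injective l →
      l.IsInvertible := by
    intro l hl
    have h1 : Module.finrank ℝ (F →L[ℝ] ℝ) = Module.finrank ℝ F :=
      (LinearMap.toContinuousLinearMap (𝕜 := ℝ) (E := F) (F' := ℝ)).finrank_eq.symm.trans
        Subspace.dual_finrank_eq
    have h2 : Module.finrank ℝ ((EQ × F) × ℝ) = Module.finrank ℝ ((EQ × (F →L[ℝ] ℝ)) × ℝ) := by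
      simp [h1]
    exact ⟨(LinearEquiv.ofInjectiveOfFinrankEq l.toLinearMap hl h2).toContinuousLinearEquiv, rfl⟩
  exact key _ (mfderiv_legendre_injective L hL p)

end legendre

/-! ### Lifting sections along the Legendre map. -/

section naturality

variable {EQ : Type*} [NormedAddCommGroup EQ] [NormedSpace ℝ EQ] [FiniteDimensional ℝ EQ]
  {Q : Type*} [TopologicalSpace Q] [T2Space Q] [ChartedSpace EQ Q] [IsManifold 𝓘(ℝ, EQ) ∞ Q]
  {F : Type*} [NormedAddCommGroup F] [NormedSpace ℝ F] [FiniteDimensional ℝ F]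
  {V : Q → Type*} [TopologicalSpace (TotalSpace F V)] [∀ q, AddCommGroup (V q)]
  [∀ q, Module ℝ (V q)] [∀ q, TopologicalSpace (V q)] [∀ q, IsTopologicalAddGroup (V q)]
  [∀ q, ContinuousSMul ℝ (V q)] [FiberBundle F V] [VectorBundle ℝ F V]
  [ContMDiffVectorBundle ∞ F V 𝓘(ℝ, EQ)]
  (𝔸 : LieAlgebroid EQ F V) {L : C^∞⟮timesRealModel EQ F, TotalSpace F V × ℝ; ℝ⟯}
  (hL : IsRegularLagrangian L)

theorem mfderiv_legendre_mpullback (hL : IsRegularLagrangian L)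
    (X : ∀ p', TangentSpace (M := TotalSpace (F →L[ℝ] ℝ) (fun q ↦ V q →L[ℝ] ℝ) × ℝ)
      (timesRealModel EQ (F →L[ℝ] ℝ)) p') (p : TotalSpace F V × ℝ) :
    mfderiv (timesRealModel EQ F) (timesRealModel EQ (F →L[ℝ] ℝ)) (legendre L) p
      (VectorField.mpullback (timesRealModel EQ F) (timesRealModel EQ (F →L[ℝ] ℝ))
        (legendre L) X p) = X (legendre L p) := by
  have key : ∀ l : (EQ × F) × ℝ →L[ℝ] (EQ × (F →L[ℝ] ℝ)) × ℝ, l.IsInvertible →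
      ∀ x, l (l.inverse x) = x := by
    rintro _ ⟨e, rfl⟩ x
    rw [ContinuousLinearMap.inverse_equiv]
    exact e.apply_symm_apply x
  exact key _ (isInvertible_mfderiv_legendre L hL p) _

/-- The pullback of a section of the prolongation along the Legendre transformation of a regular
Lagrangian. -/
noncomputable def legendrePullback
    (σ : ∀ p', 𝔸.Prolongation (timesRealModel EQ (F →L[ℝ] ℝ))
      (timesRealProj (F →L[ℝ] ℝ) (fun q ↦ V q →L[ℝ] ℝ)) p') (p : TotalSpace F V × ℝ) :
    𝔸.Prolongation (timesRealModel EQ F) (timesRealProj F V) p :=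
  ⟨((σ (legendre L p)).1.1, VectorField.mpullback (timesRealModel EQ F)
    (timesRealModel EQ (F →L[ℝ] ℝ)) (legendre L) (fun p' ↦ (σ p').1.2) p), by
    have h1 := mfderiv_comp_apply p
      ((contMDiff_timesRealProj (EQ := EQ) (W := fun q ↦ V q →L[ℝ] ℝ)).mdifferentiableAt
        (x := legendre L p) (by simp))
      ((contMDiff_legendre L).mdifferentiableAt (by simp))
      (VectorField.mpullback (timesRealModel EQ F)
        (timesRealModel EQ (F →L[ℝ] ℝ)) (legendre L) (fun p' ↦ (σ p').1.2) p)
    have h2 := congrArg (mfderiv (timesRealModel EQ (F →L[ℝ] ℝ)) 𝓘(ℝ, EQ)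
      (timesRealProj (F →L[ℝ] ℝ) (fun q ↦ V q →L[ℝ] ℝ)) (legendre L p))
      (mfderiv_legendre_mpullback hL (fun p' ↦ (σ p').1.2) p)
    have h3 : 𝔸.anchor p.1.proj (σ (legendre L p)).1.1 = _ := (σ (legendre L p)).2
    exact h3.trans (h1.trans h2).symm⟩

variable {σ τ : ∀ p', 𝔸.Prolongation (timesRealModel EQ (F →L[ℝ] ℝ))
      (timesRealProj (F →L[ℝ] ℝ) (fun q ↦ V q →L[ℝ] ℝ)) p'}
  {U : Set (TotalSpace (F →L[ℝ] ℝ) (fun q ↦ V q →L[ℝ] ℝ) × ℝ)}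

theorem prolongedLegendre_legendrePullback (p : TotalSpace F V × ℝ) :
    prolongedLegendre L 𝔸 p (legendrePullback 𝔸 hL σ p) = σ (legendre L p) :=
  Subtype.ext (Prod.ext rfl (mfderiv_legendre_mpullback hL (fun p' ↦ (σ p').1.2) p))

theorem prolongedLegendre_injective (p : TotalSpace F V × ℝ) (hL : IsRegularLagrangian L) :
    Function.Injective (prolongedLegendre L 𝔸 p) := by
  intro w w' h
  refine Subtype.ext (Prod.ext ?_ ?_)
  · exact congrArg (fun x ↦ x.1.1) h
  · exact mfderiv_legendre_injective L hL p (congrArg (fun x ↦ x.1.2) h)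

theorem smoothSectionOn_legendrePullback
    (hσ : 𝔸.SmoothSectionOn (timesRealModel EQ (F →L[ℝ] ℝ))
      (timesRealProj (F →L[ℝ] ℝ) (fun q ↦ V q →L[ℝ] ℝ)) σ U) :
    𝔸.SmoothSectionOn (timesRealModel EQ F) (timesRealProj F V) (legendrePullback 𝔸 hL σ)
      (legendre L ⁻¹' U) := by
  have : IsManifold (timesRealModel EQ F) 1 (TotalSpace F V × ℝ) :=
    IsManifold.of_le (n := ∞) (by simp)
  have : IsManifold (timesRealModel EQ (F →L[ℝ] ℝ)) 1
      (TotalSpace (F →L[ℝ] ℝ) (fun q ↦ V q →L[ℝ] ℝ) × ℝ) := IsManifold.of_le (n := ∞) (by simp)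
  have : CompleteSpace ((EQ × F) × ℝ) := FiniteDimensional.complete ℝ _
  refine ⟨hσ.1.comp (contMDiff_legendre L).contMDiffOn subset_rfl, ?_⟩
  exact ContMDiffOn.mpullback_vectorField_preimage hσ.2 (contMDiff_legendre L)
    (fun p _ ↦ isInvertible_mfderiv_legendre L hL p) (by simp)

/-- Since `Leg` covers the identity of `Q`, both flat connections come from the same trivialization
of `V`, and the chain rule suffices. -/
theorem flatDeriv_comp_legendre (hU : IsOpen U) {p : TotalSpace F V × ℝ} (hp : legendre L p ∈ U)
    (hσ : 𝔸.SmoothSectionOn (timesRealModel EQ (F →L[ℝ] ℝ))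
      (timesRealProj (F →L[ℝ] ℝ) (fun q ↦ V q →L[ℝ] ℝ)) σ U)
    (v : TangentSpace (timesRealModel EQ F) p) :
    LieAlgebroid.flatDeriv (F := F) (V := V) (timesRealModel EQ F) (timesRealProj F V)
        (fun p' ↦ (σ (legendre L p')).1.1) p v =
      LieAlgebroid.flatDeriv (F := F) (timesRealModel EQ (F →L[ℝ] ℝ))
        (timesRealProj (F →L[ℝ] ℝ) (fun q ↦ V q →L[ℝ] ℝ)) (fun p' ↦ (σ p').1.1) (legendre L p)
        (mfderiv (timesRealModel EQ F) (timesRealModel EQ (F →L[ℝ] ℝ)) (legendre L) p v) := by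
  have h1 := (contMDiffAt_totalSpace.1 (hσ.1.contMDiffAt (hU.mem_nhds hp))).2
  have h2 := mfderiv_comp_apply p (h1.mdifferentiableAt (by simp))
    ((contMDiff_legendre L).mdifferentiableAt (by simp)) v
  exact congrArg ((trivializationAt F V p.1.proj).symm p.1.proj) h2

/-- In the `V`-component the algebraic term is the same on both sides and the flat derivatives match
by the chain rule; in the tangent component the Lie bracket of vector fields is natural under
pullback. -/
theorem prolongedLegendre_prolongationBracket (hU : IsOpen U) {p : TotalSpace F V × ℝ}
    (hp : legendre L p ∈ U)
    (hσ : 𝔸.SmoothSectionOn (timesRealModel EQ (F →L[ℝ] ℝ))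
      (timesRealProj (F →L[ℝ] ℝ) (fun q ↦ V q →L[ℝ] ℝ)) σ U)
    (hτ : 𝔸.SmoothSectionOn (timesRealModel EQ (F →L[ℝ] ℝ))
      (timesRealProj (F →L[ℝ] ℝ) (fun q ↦ V q →L[ℝ] ℝ)) τ U) :
    prolongedLegendre L 𝔸 p (𝔸.prolongationBracket (timesRealModel EQ F) (timesRealProj F V)
        (legendrePullback 𝔸 hL σ) (legendrePullback 𝔸 hL τ) p) =
      𝔸.prolongationBracket (timesRealModel EQ (F →L[ℝ] ℝ))
        (timesRealProj (F →L[ℝ] ℝ) (fun q ↦ V q →L[ℝ] ℝ)) σ τ (legendre L p) := by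
  have h0 : minSmoothness ℝ 2 ≤ (∞ : WithTop ℕ∞) := by
    rw [minSmoothness_of_isRCLikeNormedField]; exact WithTop.coe_le_coe.2 le_top
  have : IsManifold (timesRealModel EQ F) (minSmoothness ℝ 2) (TotalSpace F V × ℝ) :=
    IsManifold.of_le (n := ∞) h0
  have : IsManifold (timesRealModel EQ (F →L[ℝ] ℝ)) (minSmoothness ℝ 2)
      (TotalSpace (F →L[ℝ] ℝ) (fun q ↦ V q →L[ℝ] ℝ) × ℝ) := IsManifold.of_le (n := ∞) h0
  have : CompleteSpace ((EQ × F) × ℝ) := FiniteDimensional.complete ℝ _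
  have hU' : IsOpen (legendre L ⁻¹' U) := hU.preimage (contMDiff_legendre L).continuous
  rw [LieAlgebroid.prolongationBracket, dif_pos (𝔸.prolongationBracketAux_mem hU' hp
      (smoothSectionOn_legendrePullback 𝔸 hL hσ) (smoothSectionOn_legendrePullback 𝔸 hL hτ)),
    LieAlgebroid.prolongationBracket, dif_pos (𝔸.prolongationBracketAux_mem hU hp hσ hτ)]
  have h1 : ∀ {υ : ∀ p', 𝔸.Prolongation (timesRealModel EQ (F →L[ℝ] ℝ))
      (timesRealProj (F →L[ℝ] ℝ) (fun q ↦ V q →L[ℝ] ℝ)) p'},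
      𝔸.SmoothSectionOn (timesRealModel EQ (F →L[ℝ] ℝ))
        (timesRealProj (F →L[ℝ] ℝ) (fun q ↦ V q →L[ℝ] ℝ)) υ U →
      MDifferentiableAt (timesRealModel EQ (F →L[ℝ] ℝ)) (timesRealModel EQ (F →L[ℝ] ℝ)).tangent
        (fun p' ↦ (⟨p', (υ p').1.2⟩ : TangentBundle (timesRealModel EQ (F →L[ℝ] ℝ)) _))
        (legendre L p) := fun h ↦ (h.2.contMDiffAt (hU.mem_nhds hp)).mdifferentiableAt (by simp)
  refine Subtype.ext (Prod.ext ?_ ?_)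
  · have h2 := (flatDeriv_comp_legendre 𝔸 hU hp hτ (legendrePullback 𝔸 hL σ p).1.2).trans
      (congrArg (LieAlgebroid.flatDeriv (F := F) (timesRealModel EQ (F →L[ℝ] ℝ))
        (timesRealProj (F →L[ℝ] ℝ) (fun q ↦ V q →L[ℝ] ℝ)) (fun p' ↦ (τ p').1.1) (legendre L p))
        (mfderiv_legendre_mpullback hL (fun p' ↦ (σ p').1.2) p))
    have h3 := (flatDeriv_comp_legendre 𝔸 hU hp hσ (legendrePullback 𝔸 hL τ p).1.2).trans
      (congrArg (LieAlgebroid.flatDeriv (F := F) (timesRealModel EQ (F →L[ℝ] ℝ))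
        (timesRealProj (F →L[ℝ] ℝ) (fun q ↦ V q →L[ℝ] ℝ)) (fun p' ↦ (σ p').1.1) (legendre L p))
        (mfderiv_legendre_mpullback hL (fun p' ↦ (τ p').1.2) p))
    exact congrArg₂ (· - ·) (congrArg (_ + ·) h2) h3
  · have h4 := VectorField.mpullback_mlieBracket (h1 hσ) (h1 hτ)
      ((contMDiff_legendre L).contMDiffAt (x := p)) h0
    refine (congrArg (mfderiv (timesRealModel EQ F) (timesRealModel EQ (F →L[ℝ] ℝ))
      (legendre L) p) h4.symm).trans ?_
    exact mfderiv_legendre_mpullback hL _ p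

end naturality

/-! ### The morphism property and the contact sections. -/

section morphism

variable {EQ : Type*} [NormedAddCommGroup EQ] [NormedSpace ℝ EQ] [FiniteDimensional ℝ EQ]
  {Q : Type*} [TopologicalSpace Q] [T2Space Q] [ChartedSpace EQ Q] [IsManifold 𝓘(ℝ, EQ) ∞ Q]
  {F : Type*} [NormedAddCommGroup F] [NormedSpace ℝ F] [FiniteDimensional ℝ F]
  {V : Q → Type*} [TopologicalSpace (TotalSpace F V)] [∀ q, AddCommGroup (V q)]
  [∀ q, Module ℝ (V q)] [∀ q, TopologicalSpace (V q)] [∀ q, IsTopologicalAddGroup (V q)]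
  [∀ q, ContinuousSMul ℝ (V q)] [FiberBundle F V] [VectorBundle ℝ F V]
  [ContMDiffVectorBundle ∞ F V 𝓘(ℝ, EQ)]
  (𝔸 : LieAlgebroid EQ F V) {L : C^∞⟮timesRealModel EQ F, TotalSpace F V × ℝ; ℝ⟯}

/-- Evaluating the pulled-back form on lifted sections gives the original function composed with
`Leg`, so the derivative terms agree by the chain rule and the bracket terms by naturality of the
bracket. -/
theorem koszul_pullbackForm_legendrePullback (hL : IsRegularLagrangian L) {k : ℕ}
    {μ : 𝔸.ProlongationForm (timesRealModel EQ (F →L[ℝ] ℝ))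
      (timesRealProj (F →L[ℝ] ℝ) (fun q ↦ V q →L[ℝ] ℝ)) k}
    (hμ : 𝔸.SmoothForm (timesRealModel EQ (F →L[ℝ] ℝ))
      (timesRealProj (F →L[ℝ] ℝ) (fun q ↦ V q →L[ℝ] ℝ)) μ)
    {σ : Fin (k + 1) → ∀ p', 𝔸.Prolongation (timesRealModel EQ (F →L[ℝ] ℝ))
      (timesRealProj (F →L[ℝ] ℝ) (fun q ↦ V q →L[ℝ] ℝ)) p'}
    {U : Set (TotalSpace (F →L[ℝ] ℝ) (fun q ↦ V q →L[ℝ] ℝ) × ℝ)} (hU : IsOpen U)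
    {p : TotalSpace F V × ℝ} (hp : legendre L p ∈ U)
    (hσ : ∀ i, 𝔸.SmoothSectionOn (timesRealModel EQ (F →L[ℝ] ℝ))
      (timesRealProj (F →L[ℝ] ℝ) (fun q ↦ V q →L[ℝ] ℝ)) (σ i) U) :
    𝔸.koszul (timesRealModel EQ F) (timesRealProj F V)
        (𝔸.pullbackForm (prolongedLegendre L 𝔸) μ) (fun i ↦ legendrePullback 𝔸 hL (σ i)) p =
      𝔸.koszul (timesRealModel EQ (F →L[ℝ] ℝ))
        (timesRealProj (F →L[ℝ] ℝ) (fun q ↦ V q →L[ℝ] ℝ)) μ σ (legendre L p) := by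
  have h1 : ∀ i p', prolongedLegendre L 𝔸 p' (legendrePullback 𝔸 hL (σ i) p') =
      σ i (legendre L p') := fun i p' ↦ prolongedLegendre_legendrePullback 𝔸 hL p'
  rw [LieAlgebroid.koszul, LieAlgebroid.koszul]
  congr 1
  · refine Finset.sum_congr rfl fun i _ ↦ congrArg (_ * ·) ?_
    have h2 : (fun p' ↦ 𝔸.pullbackForm (prolongedLegendre L 𝔸) μ p'
        (i.removeNth fun l ↦ legendrePullback 𝔸 hL (σ l) p')) =
        fun p' ↦ μ (legendre L p') (i.removeNth fun l ↦ σ l (legendre L p')) := by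
      funext p'
      exact congrArg (μ (legendre L p')) (funext fun j ↦ h1 (i.succAbove j) p')
    rw [h2]
    have h3 := (hμ U (fun j ↦ σ (i.succAbove j)) hU fun j ↦ hσ _).contMDiffAt (hU.mem_nhds hp)
    refine (mfderiv_comp_apply p (h3.mdifferentiableAt (by simp))
      ((contMDiff_legendre L).mdifferentiableAt (by simp)) _).trans ?_
    exact congrArg (mfderiv (timesRealModel EQ (F →L[ℝ] ℝ)) 𝓘(ℝ, ℝ) _ (legendre L p))
      (mfderiv_legendre_mpullback hL (fun p' ↦ (σ i p').1.2) p)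
  · cases k with
    | zero => rfl
    | succ n =>
      rw [LieAlgebroid.bracketTerms, LieAlgebroid.bracketTerms]
      refine Finset.sum_congr rfl fun i _ ↦ Finset.sum_congr rfl fun j _ ↦ congrArg (_ * ·) ?_
      refine congrArg (μ (legendre L p)) (funext fun l ↦ ?_)
      refine Fin.cases ?_ (fun l ↦ ?_) l
      · exact prolongedLegendre_prolongationBracket 𝔸 hL hU hp (hσ _) (hσ _)
      · exact h1 _ p

theorem smoothAlongOn_prolongedLegendre {U : Set (TotalSpace F V × ℝ)}
    {σ : ∀ p, 𝔸.Prolongation (timesRealModel EQ F) (timesRealProj F V) p}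
    (hσ : 𝔸.SmoothSectionOn (timesRealModel EQ F) (timesRealProj F V) σ U) :
    𝔸.SmoothAlongOn (timesRealModel EQ (F →L[ℝ] ℝ))
      (timesRealProj (F →L[ℝ] ℝ) (fun q ↦ V q →L[ℝ] ℝ)) (timesRealModel EQ F) (legendre L)
      (fun p ↦ prolongedLegendre L 𝔸 p (σ p)) U :=
  ⟨hσ.1, ((contMDiff_legendre L).contMDiff_tangentMap (m := ∞) (by simp)).comp_contMDiffOn hσ.2⟩

theorem smoothSectionOn_prolongFrame {G : Type*} [NormedAddCommGroup G] [NormedSpace ℝ G]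
    {W : Q → Type*} [TopologicalSpace (TotalSpace G W)] [∀ q, AddCommGroup (W q)]
    [∀ q, Module ℝ (W q)] [∀ q, TopologicalSpace (W q)] [FiberBundle G W] [VectorBundle ℝ G W]
    [ContMDiffVectorBundle ∞ G W 𝓘(ℝ, EQ)] (p₀ : TotalSpace G W × ℝ) (z : F × ((EQ × G) × ℝ)) :
    𝔸.SmoothSectionOn (timesRealModel EQ G) (timesRealProj G W)
      (fun p ↦ 𝔸.prolongFrame p₀ p z) (LieAlgebroid.prolongDomain EQ G W F V p₀) :=
  𝔸.smoothAlongOn_prolongFrame (LieAlgebroid.isOpen_prolongDomain p₀) contMDiffOn_id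
    contMDiffOn_const (fun _ h ↦ h)

theorem mdifferentiableAt_prolongCoord_prolongedLegendre (L : C^∞⟮timesRealModel EQ F,
      TotalSpace F V × ℝ; ℝ⟯) (p : TotalSpace F V × ℝ) (z : F × ((EQ × F) × ℝ)) :
    MDifferentiableAt (timesRealModel EQ F) 𝓘(ℝ, F × ((EQ × (F →L[ℝ] ℝ)) × ℝ))
      (fun p' ↦ 𝔸.prolongCoord (legendre L p) (legendre L p')
        (prolongedLegendre L 𝔸 p' (𝔸.prolongFrame p p' z))) p :=
  (𝔸.contMDiffAt_prolongCoord (LieAlgebroid.isOpen_prolongDomain p)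
    (LieAlgebroid.mem_prolongDomain_self p) (contMDiff_legendre L).contMDiffAt
    (smoothAlongOn_prolongedLegendre 𝔸 (smoothSectionOn_prolongFrame 𝔸 p z))
    (LieAlgebroid.mem_prolongDomain_self _)).mdifferentiableAt (by simp)

theorem LieAlgebroid.SmoothForm.mdifferentiableAt_prolongFrame {G : Type*} [NormedAddCommGroup G]
    [NormedSpace ℝ G] {W : Q → Type*} [TopologicalSpace (TotalSpace G W)] [∀ q, AddCommGroup (W q)]
    [∀ q, Module ℝ (W q)] [∀ q, TopologicalSpace (W q)] [FiberBundle G W] [VectorBundle ℝ G W]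
    [ContMDiffVectorBundle ∞ G W 𝓘(ℝ, EQ)] {k : ℕ}
    {μ : 𝔸.ProlongationForm (timesRealModel EQ G) (timesRealProj G W) k}
    (hμ : 𝔸.SmoothForm (timesRealModel EQ G) (timesRealProj G W) μ) (p : TotalSpace G W × ℝ)
    (z : Fin k → F × ((EQ × G) × ℝ)) :
    MDifferentiableAt (timesRealModel EQ G) 𝓘(ℝ, ℝ)
      (fun p' ↦ μ p' (fun i ↦ 𝔸.prolongFrame p p' (z i))) p :=
  ((hμ _ _ (LieAlgebroid.isOpen_prolongDomain p)
    (fun i ↦ smoothSectionOn_prolongFrame 𝔸 p (z i))).contMDiffAt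
      ((LieAlgebroid.isOpen_prolongDomain p).mem_nhds
        (LieAlgebroid.mem_prolongDomain_self p))).mdifferentiableAt (by simp)

/-- The image of a frame section is written in the frame at `legendre L p` with differentiable
coordinates; the product rule then gives differentiability of the coefficients. -/
theorem mdifferentiableAt_pullbackForm_prolongFrame {k : ℕ}
    {μ : 𝔸.ProlongationForm (timesRealModel EQ (F →L[ℝ] ℝ))
      (timesRealProj (F →L[ℝ] ℝ) (fun q ↦ V q →L[ℝ] ℝ)) k}
    (hμ : 𝔸.SmoothForm (timesRealModel EQ (F →L[ℝ] ℝ))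
      (timesRealProj (F →L[ℝ] ℝ) (fun q ↦ V q →L[ℝ] ℝ)) μ) (p : TotalSpace F V × ℝ)
    (z : Fin k → F × ((EQ × F) × ℝ)) :
    MDifferentiableAt (timesRealModel EQ F) 𝓘(ℝ, ℝ)
      (fun p' ↦ 𝔸.pullbackForm (prolongedLegendre L 𝔸) μ p'
        (fun i ↦ 𝔸.prolongFrame p p' (z i))) p := by
  have hleg : MDifferentiableAt (timesRealModel EQ F) (timesRealModel EQ (F →L[ℝ] ℝ)) (legendre L)
    p := (contMDiff_legendre L).mdifferentiableAt (by simp)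
  have h1 : ∀ y : Fin k → F × ((EQ × (F →L[ℝ] ℝ)) × ℝ),
      MDifferentiableAt (timesRealModel EQ F) 𝓘(ℝ, ℝ)
      (fun p' ↦ ((μ (legendre L p')).compLinearMap
        (𝔸.prolongFrame (legendre L p) (legendre L p'))) y) p := fun y ↦
    MDifferentiableAt.comp (I' := timesRealModel EQ (F →L[ℝ] ℝ))
      (g := fun p' ↦ μ p' (fun i ↦ 𝔸.prolongFrame (legendre L p) p' (y i))) p
      (LieAlgebroid.SmoothForm.mdifferentiableAt_prolongFrame 𝔸 hμ (legendre L p) y) hleg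
  have h2 := (mvfderiv_alternatingMap_apply h1
    (fun i ↦ mdifferentiableAt_prolongCoord_prolongedLegendre 𝔸 L p (z i))).1
  refine h2.congr_of_eventuallyEq ?_
  have h3 : ∀ᶠ p' in 𝓝 p,
      legendre L p' ∈ LieAlgebroid.prolongDomain EQ (F →L[ℝ] ℝ) (fun q ↦ V q →L[ℝ] ℝ) F V
        (legendre L p) :=
    hleg.continuousAt.preimage_mem_nhds ((LieAlgebroid.isOpen_prolongDomain _).mem_nhds
      (LieAlgebroid.mem_prolongDomain_self _))
  filter_upwards [h3] with p' hp'
  simp only [LieAlgebroid.pullbackForm, AlternatingMap.compLinearMap_apply]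
  congr 1
  funext i
  exact (𝔸.prolongFrame_prolongCoord hp' _).symm

theorem extDeriv_pullbackForm_prolongedLegendre (hL : IsRegularLagrangian L) {k : ℕ}
    {μ : 𝔸.ProlongationForm (timesRealModel EQ (F →L[ℝ] ℝ))
      (timesRealProj (F →L[ℝ] ℝ) (fun q ↦ V q →L[ℝ] ℝ)) k}
    (hμ : 𝔸.SmoothForm (timesRealModel EQ (F →L[ℝ] ℝ))
      (timesRealProj (F →L[ℝ] ℝ) (fun q ↦ V q →L[ℝ] ℝ)) μ) (p : TotalSpace F V × ℝ)
    (w : Fin (k + 1) → 𝔸.Prolongation (timesRealModel EQ F) (timesRealProj F V) p) :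
    𝔸.extDeriv (timesRealModel EQ F) (timesRealProj F V)
        (𝔸.pullbackForm (prolongedLegendre L 𝔸) μ) p w =
      𝔸.extDeriv (timesRealModel EQ (F →L[ℝ] ℝ))
        (timesRealProj (F →L[ℝ] ℝ) (fun q ↦ V q →L[ℝ] ℝ)) μ (legendre L p)
        (fun i ↦ prolongedLegendre L 𝔸 p (w i)) := by
  choose h1 U hU hUo hUs using fun i ↦ 𝔸.sectionThrough_spec (prolongedLegendre L 𝔸 p (w i))
  have hUo' : IsOpen (⋂ i, U i) := isOpen_iInter_of_finite hUo
  have hp : legendre L p ∈ ⋂ i, U i := mem_iInter.2 fun i ↦ mem_of_mem_nhds (hU i)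
  have hUs' : ∀ i, 𝔸.SmoothSectionOn (timesRealModel EQ (F →L[ℝ] ℝ))
      (timesRealProj (F →L[ℝ] ℝ) (fun q ↦ V q →L[ℝ] ℝ)) (𝔸.sectionThrough _ _
        (prolongedLegendre L 𝔸 p (w i))) (⋂ i, U i) := fun i ↦
    ⟨(hUs i).1.mono (iInter_subset _ i), (hUs i).2.mono (iInter_subset _ i)⟩
  -- The sections chosen at `legendre L p` are lifted. Their lifts need not be the sections chosen
  -- at `p`, but they have the same values at `p`, because the prolonged map is injective on fibres;
  -- tensoriality does the rest.
  refine Eq.trans ?_ (koszul_pullbackForm_legendrePullback 𝔸 hL hμ hUo' hp hUs')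
  refine 𝔸.koszul_congr (mdifferentiableAt_pullbackForm_prolongFrame 𝔸 hμ p)
    (fun i ↦ (𝔸.sectionThrough_spec (w i)).2) (fun i ↦ ?_) fun i ↦ ?_
  · exact ⟨_, (hUo'.preimage (contMDiff_legendre L).continuous).mem_nhds hp,
      hUo'.preimage (contMDiff_legendre L).continuous,
      smoothSectionOn_legendrePullback 𝔸 hL (hUs' i)⟩
  · refine (𝔸.sectionThrough_spec (w i)).1.trans ?_
    refine prolongedLegendre_injective 𝔸 p hL ?_
    rw [prolongedLegendre_legendrePullback, h1]

theorem isLieAlgebroidMorphism_prolongedLegendre (hL : IsRegularLagrangian L) :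
    𝔸.IsLieAlgebroidMorphism (timesRealModel EQ F) (timesRealProj F V)
      (timesRealModel EQ (F →L[ℝ] ℝ)) (timesRealProj (F →L[ℝ] ℝ) (fun q ↦ V q →L[ℝ] ℝ))
      (legendre L) (prolongedLegendre L 𝔸) where
  smooth_base := contMDiff_legendre L
  smooth_total _ _ _ hσ := smoothAlongOn_prolongedLegendre 𝔸 hσ
  extDeriv_pullbackForm _ _ hμ := extDeriv_pullbackForm_prolongedLegendre 𝔸 hL hμ

theorem sComponent_prolongedLegendre (p : TotalSpace F V × ℝ)
    (w : 𝔸.Prolongation (timesRealModel EQ F) (timesRealProj F V) p) :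
    sComponent 𝔸 (legendre L p) (prolongedLegendre L 𝔸 p w) = sComponent 𝔸 p w :=
  (mfderiv_comp_apply p (I'' := 𝓘(ℝ, ℝ))
    (g := (Prod.snd : TotalSpace (F →L[ℝ] ℝ) (fun q ↦ V q →L[ℝ] ℝ) × ℝ → ℝ))
    mdifferentiableAt_snd ((contMDiff_legendre L).mdifferentiableAt (by simp)) w.1.2).symm

/-- Both sides are the derivative of `L` along `t ↦ (b + ta, s)`, once by definition of the fibre
derivative and once as the vertical lift acting on `L`. -/
theorem liouville_prolongedLegendre (p : TotalSpace F V × ℝ)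
    (w : 𝔸.Prolongation (timesRealModel EQ F) (timesRealProj F V) p) :
    liouville 𝔸 (legendre L p) (prolongedLegendre L 𝔸 p w) = poincareCartan L 𝔸 p w :=
  (deriv_fibre_curve L p w.1.1).trans
    (congrArg (mfderiv (timesRealModel EQ F) 𝓘(ℝ, ℝ) L p) (mfderiv_fibre_curve p w.1.1).symm)

theorem pullbackForm_canonicalContactForm :
    𝔸.pullbackForm (prolongedLegendre L 𝔸) (canonicalContactForm 𝔸) =
      lagrangianContactForm L 𝔸 := by
  funext p
  ext w
  exact congrArg₂ (· - ·) (sComponent_prolongedLegendre 𝔸 p (w 0))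
    (liouville_prolongedLegendre 𝔸 p (w 0))

theorem smoothForm_canonicalContactForm :
    𝔸.SmoothForm (timesRealModel EQ (F →L[ℝ] ℝ))
      (timesRealProj (F →L[ℝ] ℝ) (fun q ↦ V q →L[ℝ] ℝ)) (canonicalContactForm 𝔸) := by
  intro U σ hU hσ
  have h1 := ContMDiffOn.dirDeriv_vectorField
    (f := (Prod.snd : TotalSpace (F →L[ℝ] ℝ) (fun q ↦ V q →L[ℝ] ℝ) × ℝ → ℝ)) (U := U)
    contMDiff_snd (hσ 0).2
  have h2 : ContMDiffOn (timesRealModel EQ (F →L[ℝ] ℝ)) 𝓘(ℝ, ℝ) ∞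
      (fun p ↦ p.1.snd (σ 0 p).1.1) U :=
    ContMDiffOn.dual_apply (EQ := EQ) (F := F) (V := V)
      (g := fun p : TotalSpace (F →L[ℝ] ℝ) (fun q ↦ V q →L[ℝ] ℝ) × ℝ ↦ p.1.proj)
      (ν := fun p ↦ p.1.snd) (a := fun p ↦ (σ 0 p).1.1) contMDiff_fst.contMDiffOn (hσ 0).1
  exact h1.sub h2

end morphism

theorem mainTheorem3 {EQ : Type*} [NormedAddCommGroup EQ] [NormedSpace ℝ EQ]
    [FiniteDimensional ℝ EQ]
    {Q : Type*} [TopologicalSpace Q] [T2Space Q] [ChartedSpace EQ Q] [IsManifold 𝓘(ℝ, EQ) ∞ Q]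
    {F : Type*} [NormedAddCommGroup F] [NormedSpace ℝ F] [FiniteDimensional ℝ F]
    {V : Q → Type*} [TopologicalSpace (TotalSpace F V)] [∀ q, AddCommGroup (V q)]
    [∀ q, Module ℝ (V q)] [∀ q, TopologicalSpace (V q)] [∀ q, IsTopologicalAddGroup (V q)]
    [∀ q, ContinuousSMul ℝ (V q)] [FiberBundle F V] [VectorBundle ℝ F V]
    [ContMDiffVectorBundle ∞ F V 𝓘(ℝ, EQ)]
    (𝔸 : LieAlgebroid EQ F V) (L : C^∞⟮timesRealModel EQ F, TotalSpace F V × ℝ; ℝ⟯)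
    (hL : IsRegularLagrangian L) :
    𝔸.IsLieAlgebroidMorphism (timesRealModel EQ F) (timesRealProj F V)
        (timesRealModel EQ (F →L[ℝ] ℝ)) (timesRealProj (F →L[ℝ] ℝ) (fun q ↦ V q →L[ℝ] ℝ))
        (legendre L) (prolongedLegendre L 𝔸) ∧
      𝔸.pullbackForm (prolongedLegendre L 𝔸) (canonicalContactForm 𝔸) =
        lagrangianContactForm L 𝔸 ∧
      ∀ (p : TotalSpace F V × ℝ)
        (w : Fin 2 → 𝔸.Prolongation (timesRealModel EQ F) (timesRealProj F V) p),
        𝔸.extDeriv (timesRealModel EQ (F →L[ℝ] ℝ))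
            (timesRealProj (F →L[ℝ] ℝ) (fun q ↦ V q →L[ℝ] ℝ)) (canonicalContactForm 𝔸)
            (legendre L p) (fun i ↦ prolongedLegendre L 𝔸 p (w i)) =
          𝔸.extDeriv (timesRealModel EQ F) (timesRealProj F V) (lagrangianContactForm L 𝔸) p w :=
  ⟨isLieAlgebroidMorphism_prolongedLegendre 𝔸 hL, pullbackForm_canonicalContactForm 𝔸,
    fun p w ↦ by
      -- The differential commutes with pullback for the smooth form `η`, whose pullback is already
      -- known to be `η_L`.
      rw [← extDeriv_pullbackForm_prolongedLegendre 𝔸 hL (smoothForm_canonicalContactForm 𝔸),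
        pullbackForm_canonicalContactForm]⟩
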